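/- Let $s>0$, $0<a<s/2$, $\alpha\in[0,\pi)$ with $\sin\alpha>a/s$, and let $\theta_{\mathrm I}\in\mathbb R$ with $\cos(\theta_{\mathrm I}-\alpha)<1$ and $\cos(\theta_{\mathrm I}+\alpha)<1$. Let $H^{(1)}_0$ be the Hankel function of the first kind and order zero, $\Lambda_\alpha(m,n)=(m^2+n^2-2mn\cos 2\alpha)^{1/2}$, and for $k\in\mathbb C$ with $\operatorname{Im}k>0$ put $$K(z)=H^{(1)}_0(ka)+\sum_{\ell\ge1}(z^\ell+z^{-\ell})H^{(1)}_0(ks\ell),\qquad e^{-s\operatorname{Im}k}<|z|<e^{s\operatorname{Im}k}.$$ Assume that $K$ has no zero in this annulus. The coefficients $(A_m)_{m\ge0}$ and $(B_{-m})_{m\ge1}$ of the two semi-infinite arrays of point scatterers forming the wedge are to satisfy the coupled infinite systems $$A_mH^{(1)}_0(ka)+\sum_{n\ge0,\,n\ne m}A_nH^{(1)}_0(ks|m-n|)=-\sum_{n\ge1}B_{-n}H^{(1)}_0(ks\Lambda_\alpha(m,n))-e^{-iksm\cos(\theta_{\mathrm I}-\alpha)},\quad m\ge0,\tag{1}$$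 $$B_{-m}H^{(1)}_0(ka)+\sum_{n\ge1,\,n\ne m}B_{-n}H^{(1)}_0(ks|m-n|)=-\sum_{n\ge0}A_nH^{(1)}_0(ks\Lambda_\alpha(m,n))-e^{-iksm\cos(\theta_{\mathrm I}+\alpha)},\quad m\ge1,\tag{2}$$ all series being absolutely convergent. Call such a sequence admissible if its Z-transform $\sum_{m\ge0}A_mz^m$ (respectively $\sum_{m\ge1}B_{-m}z^m$) converges absolutely on some circle $|z|=r$ with $r>e^{-s\operatorname{Im}k}$. (i) There is a function $K^+$, analytic and zero-free on $|z|<e^{s\operatorname{Im}k}$, such that with $K^-(z)=K^+(1/z)$ one has $K=K^+K^-$ on the annulus. For any such $K^+$ let $1/K^+(z)=\sum_{n\ge0}\lambda_nz^n$ be its Taylor series and put $$A^{(0)}_m=-\frac{e^{-iksm\cos(\theta_{\mathrm I}-\alpha)}}{K^+(e^{-iks\cos(\theta_{\mathrm I}-\alpha)})}\sum_{n=0}^m\lambda_ne^{iksn\cos(\theta_{\mathrm I}-\alpha)},\qquad B^{(0)}_{-m}=-\frac{e^{-iksm\cos(\theta_{\mathrm I}+\alpha)}}{K^+(e^{-iks\cos(\theta_{\mathrm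 I}+\alpha)})}\sum_{n=0}^{m-1}\lambda_ne^{iksn\cos(\theta_{\mathrm I}+\alpha)}.$$ (ii) $A^{(0)}$ (respectively $B^{(0)}$) is the unique admissible solution of (1) with $B=0$ (respectively of (2) with $A=0$), that is, of the isolated semi-infinite array problem. (iii) For every admissible $B$, an admissible $A$ satisfies (1) if and only if $$A_m=A^{(0)}_m-\sum_{q\ge1}\sum_{p\ge0}\sum_{n=0}^m\lambda_{m-n}\lambda_pB_{-q}H^{(1)}_0(ks\Lambda_\alpha(q,p+n)),\qquad m\ge0;\tag{3}$$ the double series over $(q,p)$ converges absolutely, and its right-hand side is an admissible sequence. (iv) For every admissible $A$, an admissible $B$ satisfies (2) if and only if $$B_{-m}=B^{(0)}_{-m}-\sum_{q\ge0}\sum_{p\ge0}\sum_{n=1}^m\lambda_{m-n}\lambda_pA_qH^{(1)}_0(ks\Lambda_\alpha(q,p+n)),\qquad m\ge1;\tag{4}$$ the double series converges absolutely, and its right-hand side is an admissible sequence. (v) For a real wavenumber $k_0>0$ the formulas hold in the limit $\operatorname{Im}k\to0^+$: if $k_j\to k_0$ with $\operatorname{Im}k_j>0$, the kernel for $k_j$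 is zero-free on its annulus with factor $K^+_j$, and admissible solutions $(A^{j},B^{j})$ of (1)-(2) for $k_j$ converge termwise to $(A,B)$, then the right-hand sides of (3) and (4), formed with $k_j,K^+_j,A^{j},B^{j}$, converge to $A_m$ and $B_{-m}$ for every $m$. -/

import Mathlib

open Filter Topology

noncomputable section

namespace WedgeScatterers

/-- The Hankel function of the first kind and order zero on the open upper half-plane, through its
Sommerfeld integral `H₀⁽¹⁾(z) = (2 / (π i)) ∫₀^∞ exp (i z cosh t) dt`, which is absolutely convergent
for `0 < Im z`. Only arguments with positive imaginary part occur below. -/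
def hankelH (z : ℂ) : ℂ :=
  (2 / (Real.pi * Complex.I)) *
    ∫ t in Set.Ioi (0 : ℝ), Complex.exp (Complex.I * z * (Real.cosh t : ℂ))

/-- `Λ_α(m, n) = (m² + n² - 2 m n cos 2α)^{1/2}`: the distance, in units of the spacing, between the
`m`-th scatterer of one array and the `n`-th scatterer of the other. -/
def wedgeDist (α : ℝ) (m n : ℕ) : ℝ :=
  Real.sqrt ((m : ℝ) ^ 2 + (n : ℝ) ^ 2 - 2 * m * n * Real.cos (2 * α))

/-- The plane wave of direction cosine `c` sampled at the `m`-th scatterer of an array: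
`exp (- i k s m c)`. -/
def planeWave (k : ℂ) (s c : ℝ) (m : ℕ) : ℂ :=
  Complex.exp (-(Complex.I * k * s * m * c))

/-- The discrete Wiener-Hopf kernel
`K(z) = H₀⁽¹⁾(k a) + ∑_{l ≥ 1} (z^l + z^{-l}) H₀⁽¹⁾(k s l)`. -/
def kernel (k : ℂ) (s a : ℝ) (z : ℂ) : ℂ :=
  hankelH (k * a) + ∑' l : ℕ+, (z ^ (l : ℕ) + (z⁻¹) ^ (l : ℕ)) * hankelH (k * s * (l : ℕ))

/-- The annulus `exp (- s Im k) < |z| < exp (s Im k)`. -/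
def annulus (k : ℂ) (s : ℝ) : Set ℂ :=
  {z | Real.exp (-(k.im * s)) < ‖z‖ ∧ ‖z‖ < Real.exp (k.im * s)}

/-- `Kp` is the plus factor `K⁺` of the kernel: it is analytic and zero-free on the disc
`|z| < exp (s Im k)`, and with the minus factor `K⁻(z) = K⁺(1/z)` one has `K = K⁺ K⁻` on the
annulus. -/
structure IsPlusFactor (k : ℂ) (s a : ℝ) (Kp : ℂ → ℂ) : Prop where
  analytic : AnalyticOnNhd ℂ Kp (Metric.ball 0 (Real.exp (k.im * s)))
  ne_zero : ∀ z ∈ Metric.ball (0 : ℂ) (Real.exp (k.im * s)), Kp z ≠ 0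
  factor : ∀ z ∈ annulus k s, kernel k s a z = Kp z * Kp z⁻¹

/-- The Taylor coefficients at `0` of `1 / K⁺`. -/
def lam (Kp : ℂ → ℂ) (n : ℕ) : ℂ :=
  iteratedDeriv n (fun z => (Kp z)⁻¹) 0 / (n.factorial : ℂ)

/-- Admissible coefficients of the upper array: the Z-transform `∑ A_m z^m` converges absolutely
on some circle lying in `|z| > exp (- s Im k)`. -/
def AdmissibleTop (k : ℂ) (s : ℝ) (A : ℕ → ℂ) : Prop :=
  ∃ r : ℝ, Real.exp (-(k.im * s)) < r ∧ Summable fun m : ℕ => ‖A m‖ * r ^ m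

/-- Admissible coefficients of the lower array. Here and below `B n` (for `n ≥ 1`) is the coefficient
`B_{-n}` of the scatterer with index `-n`. -/
def AdmissibleBot (k : ℂ) (s : ℝ) (B : ℕ+ → ℂ) : Prop :=
  ∃ r : ℝ, Real.exp (-(k.im * s)) < r ∧ Summable fun n : ℕ+ => ‖B n‖ * r ^ (n : ℕ)

/-- The infinite system of the upper array, for `m ≥ 0`. With `B = 0` it is the system of the
upper array in isolation. -/
def TopSystem (k : ℂ) (s a α θ : ℝ) (A : ℕ → ℂ) (B : ℕ+ → ℂ) : Prop :=
  ∀ m : ℕ,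
    (Summable fun n : ℕ =>
      if n = m then 0 else A n * hankelH (k * s * (|(m : ℝ) - (n : ℝ)| : ℝ))) ∧
    (Summable fun n : ℕ+ => B n * hankelH (k * s * (wedgeDist α m n : ℝ))) ∧
    A m * hankelH (k * a) +
        ∑' n : ℕ, (if n = m then 0 else A n * hankelH (k * s * (|(m : ℝ) - (n : ℝ)| : ℝ))) =
      -(∑' n : ℕ+, B n * hankelH (k * s * (wedgeDist α m n : ℝ)))
        - planeWave k s (Real.cos (θ - α)) m

/-- The infinite system of the lower array, written for the index `-m` with `m ≥ 1`. With `A = 0` it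
is the system of the lower array in isolation. -/
def BotSystem (k : ℂ) (s a α θ : ℝ) (A : ℕ → ℂ) (B : ℕ+ → ℂ) : Prop :=
  ∀ m : ℕ+,
    (Summable fun n : ℕ+ =>
      if n = m then 0
      else B n * hankelH (k * s * (|((m : ℕ) : ℝ) - ((n : ℕ) : ℝ)| : ℝ))) ∧
    (Summable fun n : ℕ => A n * hankelH (k * s * (wedgeDist α m n : ℝ))) ∧
    B m * hankelH (k * a) +
        ∑' n : ℕ+, (if n = m then 0
          else B n * hankelH (k * s * (|((m : ℕ) : ℝ) - ((n : ℕ) : ℝ)| : ℝ))) =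
      -(∑' n : ℕ, A n * hankelH (k * s * (wedgeDist α m n : ℝ)))
        - planeWave k s (Real.cos (θ + α)) m

/-- The isolated coefficients `A⁽⁰⁾_m` of the upper array, with `c = cos (θ - α)`:
`- exp (-i k s m c) / K⁺(exp (-i k s c)) * ∑_{n=0}^{m} λ_n exp (i k s n c)`. -/
def isoTop (k : ℂ) (s α θ : ℝ) (Kp : ℂ → ℂ) (m : ℕ) : ℂ :=
  -(planeWave k s (Real.cos (θ - α)) m / Kp (planeWave k s (Real.cos (θ - α)) 1)) *
    ∑ n ∈ Finset.range (m + 1), lam Kp n * (planeWave k s (Real.cos (θ - α)) n)⁻¹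

/-- The isolated coefficients `B⁽⁰⁾_{-m}` of the lower array (`m ≥ 1`), with `c = cos (θ + α)`:
`- exp (-i k s m c) / K⁺(exp (-i k s c)) * ∑_{n=0}^{m-1} λ_n exp (i k s n c)`. -/
def isoBot (k : ℂ) (s α θ : ℝ) (Kp : ℂ → ℂ) (m : ℕ+) : ℂ :=
  -(planeWave k s (Real.cos (θ + α)) m / Kp (planeWave k s (Real.cos (θ + α)) 1)) *
    ∑ n ∈ Finset.range (m : ℕ), lam Kp n * (planeWave k s (Real.cos (θ + α)) n)⁻¹

/-- The summand `∑_{n=0}^{m} λ_{m-n} λ_p B_{-q} H₀⁽¹⁾(k s Λ_α(q, p+n))`. -/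
def topTerm (k : ℂ) (s α : ℝ) (Kp : ℂ → ℂ) (B : ℕ+ → ℂ) (m : ℕ) (q : ℕ+) (p : ℕ) : ℂ :=
  ∑ n ∈ Finset.range (m + 1),
    lam Kp (m - n) * lam Kp p * B q * hankelH (k * s * (wedgeDist α q (p + n) : ℝ))

/-- The summand `∑_{n=1}^{m} λ_{m-n} λ_p A_q H₀⁽¹⁾(k s Λ_α(q, p+n))`, for the index `-m`. -/
def botTerm (k : ℂ) (s α : ℝ) (Kp : ℂ → ℂ) (A : ℕ → ℂ) (m : ℕ+) (q p : ℕ) : ℂ :=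
  ∑ n ∈ Finset.Icc 1 (m : ℕ),
    lam Kp ((m : ℕ) - n) * lam Kp p * A q * hankelH (k * s * (wedgeDist α q (p + n) : ℝ))

/-- `A⁽⁰⁾_m - ∑_{q ≥ 1} ∑_{p ≥ 0} ∑_{n=0}^{m} λ_{m-n} λ_p B_{-q} H₀⁽¹⁾(k s Λ_α(q, p+n))`. -/
def topFormula (k : ℂ) (s α θ : ℝ) (Kp : ℂ → ℂ) (B : ℕ+ → ℂ) (m : ℕ) : ℂ :=
  isoTop k s α θ Kp m - ∑' q : ℕ+, ∑' p : ℕ, topTerm k s α Kp B m q p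

/-- `B⁽⁰⁾_{-m} - ∑_{q ≥ 0} ∑_{p ≥ 0} ∑_{n=1}^{m} λ_{m-n} λ_p A_q H₀⁽¹⁾(k s Λ_α(q, p+n))`. -/
def botFormula (k : ℂ) (s α θ : ℝ) (Kp : ℂ → ℂ) (A : ℕ → ℂ) (m : ℕ+) : ℂ :=
  isoBot k s α θ Kp m - ∑' q : ℕ, ∑' p : ℕ, botTerm k s α Kp A m q p

end WedgeScatterers

end

noncomputable section

namespace WedgeScatterers

/-! ### Decay of the Hankel function and distances in the wedge -/

/-! Each of the two systems is a Toeplitz system on the half line whose symbol is the kernel `K`,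
with a right-hand side made of a plane wave and the field of the other array. The factorisation of
`K` into `K⁺(z) K⁺(1/z)` writes the Toeplitz operator as an upper triangular operator with symbol
`K⁺(1/z)` applied after a lower triangular one with symbol `K⁺` (`hasSum_toeplitz`). Both factors
are inverted by the Taylor coefficients `λ` of `1/K⁺`, so the solution is `lowerConv λ (upperConv λ
f)` (`toeplitz_system_iff`).

With `R = exp (s Im k)`, admissibility means growth `O(t ^ n)` for some `1 ≤ t < R`. The Taylor
series of `K⁺` and `1/K⁺` converge absolutely at `t`, so all the operators act on such sequences and
all rearrangements are legitimate. The source is of the same class: `H₀⁽¹⁾` decays like `exp (-s Im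
k |n - q|)` between the arrays, and the plane wave is a geometric sequence of ratio `w` with `‖w‖ <
R`. On `w ^ n` the upper operator is multiplication by `1/K⁺(w)`, which produces the isolated
coefficients (`IsPlusFactor.lowerConv_upperConv_sub`); on the field of the other array it produces
the double series (`lowerConv_upperConv_source`).

The factor is obtained from the logarithmic derivative `z K'/K` (`exists_isPlusFactor`). It is odd
under `z ↦ 1/z` because `K` is even, so its Laurent series has no constant term and splits as `z
Q(z) - z⁻¹ Q(1/z)`. With `E` a primitive of `Q`, `K⁺` is a constant times `exp E`. -/

lemma one_add_sq_half_le_cosh {t : ℝ} (ht : 0 ≤ t) : 1 + t ^ 2 / 2 ≤ Real.cosh t := by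
  have h1 : Real.cosh t = 1 + 2 * Real.sinh (t / 2) ^ 2 := by
    have h2 := Real.cosh_two_mul (t / 2)
    have h3 := Real.cosh_sq (t / 2)
    rw [mul_div_cancel₀ t two_ne_zero] at h2
    linarith
  have h4 : t / 2 ≤ Real.sinh (t / 2) := Real.self_le_sinh_iff.2 (by positivity)
  have h5 : (t / 2) ^ 2 ≤ Real.sinh (t / 2) ^ 2 := pow_le_pow_left₀ (by positivity) h4 2
  rw [h1]
  nlinarith

/-- The bound `cosh t ≥ 1 + t²/2` splits the Sommerfeld integrand into `exp (-Im z)` and a Gaussian.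
The distance `δ` from the real axis makes the Gaussian integral independent of `z`. -/
lemma exists_norm_hankelH_le {δ : ℝ} (hδ : 0 < δ) :
    ∃ C : ℝ, 0 ≤ C ∧ ∀ z : ℂ, δ ≤ z.im → ‖hankelH z‖ ≤ C * Real.exp (-z.im) := by
  set J : ℝ := ∫ t in Set.Ioi (0 : ℝ), Real.exp (-(δ / 2) * t ^ 2) with hJ
  have hint : MeasureTheory.IntegrableOn (fun t : ℝ => Real.exp (-(δ / 2) * t ^ 2))
      (Set.Ioi 0) := (integrable_exp_neg_mul_sq (half_pos hδ)).integrableOn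
  have hJ0 : 0 ≤ J := MeasureTheory.integral_nonneg fun t => (Real.exp_pos _).le
  refine ⟨‖(2 / (Real.pi * Complex.I) : ℂ)‖ * J, by positivity, fun z hz => ?_⟩
  have key : ‖∫ t in Set.Ioi (0 : ℝ), Complex.exp (Complex.I * z * (Real.cosh t : ℂ))‖ ≤
      ∫ t in Set.Ioi (0 : ℝ), Real.exp (-z.im) * Real.exp (-(δ / 2) * t ^ 2) := by
    refine MeasureTheory.norm_integral_le_of_norm_le (hint.const_mul _) ?_
    refine (MeasureTheory.ae_restrict_iff' measurableSet_Ioi).2 (Eventually.of_forall ?_)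
    intro t ht
    have hre : (Complex.I * z * (Real.cosh t : ℂ)).re = -z.im * Real.cosh t := by
      simp [Complex.mul_re]
    rw [Complex.norm_exp, hre, ← Real.exp_add]
    have h1 := one_add_sq_half_le_cosh (le_of_lt (Set.mem_Ioi.1 ht))
    have h2 : 0 < z.im := hδ.trans_le hz
    have h3 := mul_le_mul_of_nonneg_left h1 h2.le
    have h4 : δ * (t ^ 2 / 2) ≤ z.im * (t ^ 2 / 2) := by gcongr
    exact Real.exp_le_exp.2 (by linarith)
  rw [MeasureTheory.integral_const_mul] at key
  rw [hankelH, norm_mul, mul_assoc]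
  gcongr
  linarith [key, mul_comm (Real.exp (-z.im)) J]

lemma wedgeDist_comm (α : ℝ) (m n : ℕ) : wedgeDist α m n = wedgeDist α n m := by
  unfold wedgeDist
  ring_nf

lemma wedgeDist_sq_eq (α : ℝ) (m n : ℕ) :
    (m : ℝ) ^ 2 + (n : ℝ) ^ 2 - 2 * m * n * Real.cos (2 * α) =
      ((m : ℝ) - n) ^ 2 + 4 * m * n * Real.sin α ^ 2 := by
  rw [Real.cos_two_mul, Real.cos_sq']
  ring

/-- From `Λ² = (m - n)² + 4 m n sin² α`: the coupling between the arrays decays off the diagonal at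
least as fast as the coupling within one array. -/
lemma natAbs_sub_le_wedgeDist (α : ℝ) (m n : ℕ) :
    (((m : ℤ) - n).natAbs : ℝ) ≤ wedgeDist α m n := by
  unfold wedgeDist
  refine Real.le_sqrt_of_sq_le ?_
  rw [wedgeDist_sq_eq, Nat.cast_natAbs, Int.cast_abs, sq_abs]
  push_cast
  have : 0 ≤ 4 * (m : ℝ) * n * Real.sin α ^ 2 := by positivity
  linarith

/-- Distinct scatterers of the wedge stay apart. -/
lemma exists_le_wedgeDist {α : ℝ} (hα : 0 < Real.sin α) :
    ∃ δ : ℝ, 0 < δ ∧ ∀ m n : ℕ, m ≠ 0 ∨ n ≠ 0 → δ ≤ wedgeDist α m n := by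
  -- Pairs of different index are at least `1` apart, and a pair of equal index `m ≥ 1` is at
  -- distance `2 m sin α`.
  refine ⟨min 1 (Real.sin α), by positivity, fun m n h => ?_⟩
  by_cases hmn : m = n
  · subst hmn
    refine (min_le_right _ _).trans (Real.le_sqrt_of_sq_le ?_)
    rw [wedgeDist_sq_eq]
    have hm : (1 : ℝ) ≤ m := by
      exact_mod_cast Nat.one_le_iff_ne_zero.2 (by tauto)
    have : 1 ≤ 4 * (m : ℝ) * m := by nlinarith
    nlinarith [sq_nonneg (Real.sin α)]
  · refine (min_le_left _ _).trans (le_trans ?_ (natAbs_sub_le_wedgeDist α m n))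
    have : 1 ≤ ((m : ℤ) - n).natAbs := by omega
    exact_mod_cast this

/-! ### Sequences of exponential growth -/

/-- `f n = O(t ^ n)`. -/
def Grows (t : ℝ) (f : ℕ → ℂ) : Prop := ∃ C : ℝ, 0 ≤ C ∧ ∀ n, ‖f n‖ ≤ C * t ^ n

lemma Grows.mono {t u : ℝ} (ht : 0 ≤ t) (htu : t ≤ u) {f : ℕ → ℂ} (hf : Grows t f) :
    Grows u f := by
  obtain ⟨C, hC, h⟩ := hf
  exact ⟨C, hC, fun n => (h n).trans (by gcongr)⟩

lemma Grows.add {t : ℝ} {f g : ℕ → ℂ} (hf : Grows t f) (hg : Grows t g) :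
    Grows t fun n => f n + g n := by
  obtain ⟨C, hC, h⟩ := hf
  obtain ⟨D, hD, h'⟩ := hg
  exact ⟨C + D, by positivity, fun n => (norm_add_le _ _).trans (by
    rw [add_mul]; exact add_le_add (h n) (h' n))⟩

lemma Grows.neg {t : ℝ} {f : ℕ → ℂ} (hf : Grows t f) : Grows t fun n => -f n := by
  obtain ⟨C, hC, h⟩ := hf
  exact ⟨C, hC, fun n => by rw [norm_neg]; exact h n⟩

lemma Grows.shift {t : ℝ} (ht : 0 ≤ t) {f : ℕ → ℂ} (hf : Grows t f) :
    Grows t fun n => f (n + 1) := by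
  obtain ⟨C, hC, h⟩ := hf
  exact ⟨C * t, by positivity, fun n => (h _).trans_eq (by ring)⟩

lemma grows_pow (w : ℂ) {t : ℝ} (h : ‖w‖ ≤ t) : Grows t fun n => w ^ n :=
  ⟨1, zero_le_one, fun n => by rw [norm_pow, one_mul]; gcongr⟩

/-- Absolute convergence of the Z-transform on a circle of radius larger than `1 / R` amounts to
growth slower than `R ^ n`. -/
lemma exists_summable_iff_grows {R : ℝ} (hR : 1 < R) (f : ℕ → ℂ) :
    (∃ r : ℝ, R⁻¹ < r ∧ Summable fun m : ℕ => ‖f m‖ * r ^ m) ↔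
      ∃ t : ℝ, 1 ≤ t ∧ t < R ∧ Grows t f := by
  have hR0 : 0 < R := by linarith
  constructor
  · rintro ⟨r, hr, hs⟩
    have hr0 : 0 < r := (inv_pos.2 hR0).trans hr
    have hg : Grows r⁻¹ f := by
      refine ⟨∑' m, ‖f m‖ * r ^ m, tsum_nonneg fun m => by positivity, fun n => ?_⟩
      have h1 := hs.le_tsum n fun m _ => by positivity
      rw [inv_pow, ← div_eq_mul_inv, le_div_iff₀ (by positivity)]
      exact h1
    -- Growth rates are kept at least `1` so that `t ^ n` is nondecreasing in `n`.
    exact ⟨max 1 r⁻¹, le_max_left _ _, max_lt hR (inv_lt_of_inv_lt₀ hR0 hr),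
      hg.mono (by positivity) (le_max_right _ _)⟩
  · rintro ⟨t, ht, htR, C, hC, h⟩
    obtain ⟨u, htu, huR⟩ := exists_between htR
    have ht0 : 0 < t := by linarith
    have hu0 : 0 < u := by linarith
    refine ⟨u⁻¹, (inv_lt_inv₀ hR0 hu0).2 huR, ?_⟩
    refine Summable.of_nonneg_of_le (fun m => by positivity) (fun m => ?_)
      ((summable_geometric_of_lt_one (r := t / u) (by positivity)
        ((div_lt_one hu0).2 htu)).mul_left C)
    calc ‖f m‖ * u⁻¹ ^ m ≤ C * t ^ m * u⁻¹ ^ m := by gcongr; exact h m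
      _ = C * (t / u) ^ m := by rw [div_eq_mul_inv, mul_pow]; ring

lemma admissibleTop_iff {k : ℂ} {s : ℝ} (h : 0 < k.im * s) (A : ℕ → ℂ) :
    AdmissibleTop k s A ↔ ∃ t : ℝ, 1 ≤ t ∧ t < Real.exp (k.im * s) ∧ Grows t A := by
  rw [← exists_summable_iff_grows (Real.one_lt_exp_iff.2 h), ← Real.exp_neg]
  rfl

/-- Renumbering from `n ≥ 1` to `n ≥ 0` only multiplies the Z-transform by the nonzero factor `r`.
-/
lemma admissibleBot_iff {k : ℂ} {s : ℝ} (h : 0 < k.im * s) (B : ℕ+ → ℂ) :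
    AdmissibleBot k s B ↔
      ∃ t : ℝ, 1 ≤ t ∧ t < Real.exp (k.im * s) ∧ Grows t fun n => B n.succPNat := by
  rw [← exists_summable_iff_grows (Real.one_lt_exp_iff.2 h), ← Real.exp_neg]
  refine exists_congr fun r => and_congr_right fun hr => ?_
  have hr0 : r ≠ 0 := ((Real.exp_pos _).trans hr).ne'
  rw [← Equiv.pnatEquivNat.symm.summable_iff, 
    ← summable_mul_right_iff hr0 (f := fun m : ℕ => ‖B m.succPNat‖ * r ^ m)]
  refine summable_congr fun n => ?_
  simp [Equiv.pnatEquivNat, pow_succ, mul_assoc]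

lemma summable_pow_natAbs {ρ : ℝ} (h0 : 0 ≤ ρ) (h1 : ρ < 1) :
    Summable fun j : ℤ => ρ ^ j.natAbs := by
  rw [summable_int_iff_summable_nat_and_neg]
  simpa using summable_geometric_of_lt_one h0 h1

/-- Since `q ≤ n + |n - q|`, the growth of a coefficient at `q` is charged to the distance from `n`.
For `t < exp σ` the ratio `t exp (-σ)` is below `1` and the sum over `q` converges. -/
lemma pow_mul_exp_natAbs_le {σ t : ℝ} (ht : 1 ≤ t) (n q : ℕ) :
    t ^ q * Real.exp (-σ * ((n : ℤ) - q).natAbs) ≤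
      t ^ n * (t * Real.exp (-σ)) ^ ((n : ℤ) - q).natAbs := by
  have h : q ≤ n + ((n : ℤ) - q).natAbs := by omega
  rw [mul_pow, ← Real.exp_nat_mul, ← mul_assoc, ← pow_add, mul_comm (-σ)]
  gcongr

/-! ### Triangular Toeplitz operators -/

/-- The lower triangular Toeplitz operator with symbol `∑ a_n z ^ n`. -/
def lowerConv (a A : ℕ → ℂ) (m : ℕ) : ℂ := ∑ n ∈ Finset.range (m + 1), a (m - n) * A n

/-- The upper triangular Toeplitz operator with symbol `∑ a_n z ^ (-n)`. -/
def upperConv (a g : ℕ → ℂ) (n : ℕ) : ℂ := ∑' p : ℕ, a p * g (n + p)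

/-- The power series with coefficients `a` and `b` are inverse to each other. -/
def ConvInverse (a b : ℕ → ℂ) : Prop :=
  ∀ n, ∑ x ∈ Finset.HasAntidiagonal.antidiagonal n, a x.1 * b x.2 = if n = 0 then 1 else 0

lemma ConvInverse.symm {a b : ℕ → ℂ} (h : ConvInverse a b) : ConvInverse b a := fun n => by
  rw [← h n, ← Finset.Nat.sum_antidiagonal_swap]
  exact Finset.sum_congr rfl fun x _ => mul_comm _ _

lemma lowerConv_eq_coeff (a A : ℕ → ℂ) (m : ℕ) :
    lowerConv a A m = PowerSeries.coeff m (PowerSeries.mk A * PowerSeries.mk a) := by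
  rw [PowerSeries.coeff_mul, Finset.Nat.sum_antidiagonal_eq_sum_range_succ_mk]
  exact Finset.sum_congr rfl fun x _ => by simp [mul_comm]

/-- Every entry is a finite sum, so this is an identity between formal power series and needs no
convergence. -/
lemma lowerConv_lowerConv {a b : ℕ → ℂ} (h : ConvInverse a b) (A : ℕ → ℂ) :
    lowerConv a (lowerConv b A) = A := by
  have h1 : PowerSeries.mk b * PowerSeries.mk a = 1 := by
    ext n
    rw [PowerSeries.coeff_mul, PowerSeries.coeff_one, ← h.symm n]
    simp
  have h2 : PowerSeries.mk (lowerConv b A) = PowerSeries.mk A * PowerSeries.mk b := by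
    ext n
    rw [PowerSeries.coeff_mk, lowerConv_eq_coeff]
  funext m
  rw [lowerConv_eq_coeff, h2, mul_assoc, h1, mul_one, PowerSeries.coeff_mk]

lemma summable_upperConv {a g : ℕ → ℂ} {t : ℝ} (ha : Summable fun p => ‖a p‖ * t ^ p)
    (hg : Grows t g) (n : ℕ) : Summable fun p => ‖a p * g (n + p)‖ := by
  obtain ⟨C, hC, h⟩ := hg
  refine Summable.of_nonneg_of_le (fun p => norm_nonneg _) (fun p => ?_)
    (ha.mul_right (C * t ^ n))
  rw [norm_mul]
  calc ‖a p‖ * ‖g (n + p)‖ ≤ ‖a p‖ * (C * t ^ (n + p)) := by gcongr; exact h _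
    _ = ‖a p‖ * t ^ p * (C * t ^ n) := by ring

lemma grows_upperConv {a g : ℕ → ℂ} {t : ℝ} (ht : 0 ≤ t) (ha : Summable fun p => ‖a p‖ * t ^ p)
    (hg : Grows t g) : Grows t (upperConv a g) := by
  obtain ⟨C, hC, h⟩ := id hg
  refine ⟨(∑' p, ‖a p‖ * t ^ p) * C,
    mul_nonneg (tsum_nonneg fun p => by positivity) hC, fun n => ?_⟩
  have hs := summable_upperConv ha hg n
  refine (norm_tsum_le_tsum_norm hs).trans ?_
  rw [mul_assoc, ← tsum_mul_right]
  refine hs.tsum_le_tsum (fun p => ?_) (ha.mul_right _)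
  rw [norm_mul]
  calc ‖a p‖ * ‖g (n + p)‖ ≤ ‖a p‖ * (C * t ^ (n + p)) := by gcongr; exact h _
    _ = ‖a p‖ * t ^ p * (C * t ^ n) := by ring

/-- The norms are bounded inside the sum because this also serves as the row estimate for the double
series in `hasSum_toeplitz`. -/
lemma norm_lowerConv_le {a A : ℕ → ℂ} {t C : ℝ} (ht : 1 ≤ t)
    (ha : Summable fun p => ‖a p‖) (hC : 0 ≤ C) (h : ∀ n, ‖A n‖ ≤ C * t ^ n) (m : ℕ) :
    ∑ n ∈ Finset.range (m + 1), ‖a (m - n) * A n‖ ≤ (∑' p, ‖a p‖) * C * t ^ m := by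
  calc ∑ n ∈ Finset.range (m + 1), ‖a (m - n) * A n‖
      ≤ ∑ n ∈ Finset.range (m + 1), ‖a (m - n)‖ * (C * t ^ m) := by
        refine Finset.sum_le_sum fun n hn => ?_
        rw [norm_mul]
        refine mul_le_mul_of_nonneg_left ((h n).trans ?_) (norm_nonneg _)
        have : n ≤ m := Nat.lt_succ_iff.1 (Finset.mem_range.1 hn)
        gcongr
    _ = (∑ n ∈ Finset.range (m + 1), ‖a n‖) * (C * t ^ m) := by
        rw [← Finset.sum_mul]
        congr 1
        exact Finset.sum_range_reflect (fun j => ‖a j‖) (m + 1)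
    _ ≤ (∑' p, ‖a p‖) * (C * t ^ m) := by
        gcongr
        exact ha.sum_le_tsum _ fun _ _ => norm_nonneg _
    _ = _ := by ring

lemma summable_norm_of_weighted {a : ℕ → ℂ} {t : ℝ} (ht : 1 ≤ t)
    (ha : Summable fun p => ‖a p‖ * t ^ p) : Summable fun p => ‖a p‖ :=
  Summable.of_nonneg_of_le (fun _ => norm_nonneg _)
    (fun _ => le_mul_of_one_le_right (norm_nonneg _) (one_le_pow₀ ht)) ha

lemma grows_lowerConv {a A : ℕ → ℂ} {t : ℝ} (ht : 1 ≤ t)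
    (ha : Summable fun p => ‖a p‖) (hA : Grows t A) : Grows t (lowerConv a A) := by
  obtain ⟨C, hC, h⟩ := hA
  exact ⟨(∑' p, ‖a p‖) * C, mul_nonneg (tsum_nonneg fun p => norm_nonneg _) hC,
    fun m => (norm_sum_le _ _).trans (norm_lowerConv_le ht ha hC h m)⟩

/-- The double series converges absolutely and is summed along `p + q = j`. The source then depends
only on `j`, and the convolution kills every `j ≠ 0`. -/
lemma upperConv_upperConv {a b g : ℕ → ℂ} {t : ℝ} (ht : 0 ≤ t) (h : ConvInverse a b)
    (ha : Summable fun p => ‖a p‖ * t ^ p) (hb : Summable fun p => ‖b p‖ * t ^ p)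
    (hg : Grows t g) : upperConv a (upperConv b g) = g := by
  funext n
  obtain ⟨C, hC, hgn⟩ := id hg
  have hs : Summable fun x : ℕ × ℕ => a x.1 * b x.2 * g (n + (x.1 + x.2)) := by
    refine Summable.of_norm (Summable.of_nonneg_of_le (fun x => norm_nonneg _) (fun x => ?_)
      ((ha.mul_of_nonneg hb (fun p => by positivity) (fun p => by positivity)).mul_right
        (C * t ^ n)))
    rw [norm_mul, norm_mul]
    calc ‖a x.1‖ * ‖b x.2‖ * ‖g (n + (x.1 + x.2))‖
        ≤ ‖a x.1‖ * ‖b x.2‖ * (C * t ^ (n + (x.1 + x.2))) := by gcongr; exact hgn _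
      _ = _ := by ring
  have h1 : upperConv a (upperConv b g) n =
      ∑' x : ℕ × ℕ, a x.1 * b x.2 * g (n + (x.1 + x.2)) := by
    rw [hs.tsum_prod, upperConv]
    refine tsum_congr fun p => ?_
    rw [upperConv, ← tsum_mul_left]
    exact tsum_congr fun q => by rw [mul_assoc, add_assoc]
  rw [h1, ← Finset.HasAntidiagonal.sigmaAntidiagonalEquivProd.tsum_eq]
  refine (Summable.tsum_sigma'
      (f := fun c : (j : ℕ) × Finset.HasAntidiagonal.antidiagonal j => a c.2.1.1 * b c.2.1.2 *
        g (n + (c.2.1.1 + c.2.1.2)))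
      (fun j => (hasSum_fintype _).summable)
      (Finset.HasAntidiagonal.sigmaAntidiagonalEquivProd.summable_iff.2 hs)).trans ?_
  have h2 : ∀ j : ℕ, (∑' y : Finset.HasAntidiagonal.antidiagonal j, a y.1.1 * b y.1.2 *
      g (n + (y.1.1 + y.1.2))) = if j = 0 then g n else 0 := fun j => by
    rw [Finset.tsum_subtype (Finset.HasAntidiagonal.antidiagonal j)
      (fun y : ℕ × ℕ => a y.1 * b y.2 * g (n + (y.1 + y.2))),
      Finset.sum_congr rfl (g := fun y : ℕ × ℕ => a y.1 * b y.2 * g (n + j))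
        (fun y hy => by rw [Finset.HasAntidiagonal.mem_antidiagonal.1 hy]), ← Finset.sum_mul, h j]
    split_ifs with hj
    · rw [hj, one_mul, add_zero]
    · rw [zero_mul]
  rw [tsum_congr h2, tsum_ite_eq]

/-- The extension by zero of a sequence to the integers. -/
def zeroExt (a : ℕ → ℂ) (j : ℤ) : ℂ := if 0 ≤ j then a j.toNat else 0

lemma zeroExt_sub_of_le (a : ℕ → ℂ) {i n : ℕ} (h : n ≤ i) :
    zeroExt a ((i : ℤ) - n) = a (i - n) := by
  rw [zeroExt, if_pos (by omega)]
  congr 1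
  omega

lemma zeroExt_sub_of_lt (a : ℕ → ℂ) {i n : ℕ} (h : i < n) :
    zeroExt a ((i : ℤ) - n) = 0 := by
  rw [zeroExt, if_neg (by omega)]

lemma hasSum_lowerConv (a A : ℕ → ℂ) (m : ℕ) :
    HasSum (fun n : ℕ => zeroExt a ((m : ℤ) - n) * A n) (lowerConv a A m) := by
  have h : lowerConv a A m =
      ∑ n ∈ Finset.range (m + 1), zeroExt a ((m : ℤ) - n) * A n :=
    Finset.sum_congr rfl fun n hn => by
      rw [zeroExt_sub_of_le a (Nat.lt_succ_iff.1 (Finset.mem_range.1 hn))]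
  rw [h]
  refine hasSum_sum_of_ne_finset_zero fun n hn => ?_
  rw [zeroExt_sub_of_lt a (by simpa using hn), zero_mul]

/-- A Toeplitz operator with symbol `K⁺ K⁻` is the product of two triangular ones. -/
lemma hasSum_toeplitz {κ a A : ℕ → ℂ} {t : ℝ} (ht : 1 ≤ t)
    (ha : Summable fun p => ‖a p‖ * t ^ p)
    (hκ : ∀ j : ℤ, ∑' p : ℕ, a p * zeroExt a (p + j) = κ j.natAbs)
    (hA : Grows t A) (m : ℕ) :
    HasSum (fun n : ℕ => A n * κ ((m : ℤ) - n).natAbs) (upperConv a (lowerConv a A) m) := by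
  have ht0 : 0 ≤ t := by linarith
  have ha1 := summable_norm_of_weighted ht ha
  obtain ⟨C, hC, h⟩ := id hA
  have hrow : ∀ p : ℕ, HasSum
      (fun n : ℕ => ‖a p * (zeroExt a (((m + p : ℕ) : ℤ) - n) * A n)‖)
      (∑ n ∈ Finset.range (m + p + 1), ‖a p * (a (m + p - n) * A n)‖) := fun p => by
    have h1 : ∑ n ∈ Finset.range (m + p + 1), ‖a p * (a (m + p - n) * A n)‖ =
        ∑ n ∈ Finset.range (m + p + 1),
          ‖a p * (zeroExt a (((m + p : ℕ) : ℤ) - n) * A n)‖ :=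
      Finset.sum_congr rfl fun n hn => by
        rw [zeroExt_sub_of_le a (Nat.lt_succ_iff.1 (Finset.mem_range.1 hn))]
    rw [h1]
    refine hasSum_sum_of_ne_finset_zero fun n hn => ?_
    rw [zeroExt_sub_of_lt a (by simpa using hn), zero_mul, mul_zero, norm_zero]
  -- Row `p` is at most a constant times `‖a p‖ * t ^ p * t ^ m`. Summing over `n` first gives the
  -- product of triangular operators; summing over `p` first gives the Toeplitz entries.
  have hs : Summable fun x : ℕ × ℕ =>
      a x.1 * (zeroExt a (((m + x.1 : ℕ) : ℤ) - x.2) * A x.2) := by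
    refine Summable.of_norm ((summable_prod_of_nonneg fun x => norm_nonneg _).2
      ⟨fun p => (hrow p).summable, ?_⟩)
    refine Summable.of_nonneg_of_le (fun p => tsum_nonneg fun n => norm_nonneg _) (fun p => ?_)
      (ha.mul_right ((∑' p, ‖a p‖) * C * t ^ m))
    rw [(hrow p).tsum_eq]
    simp_rw [norm_mul (a p)]
    rw [← Finset.mul_sum]
    calc ‖a p‖ * ∑ n ∈ Finset.range (m + p + 1), ‖a (m + p - n) * A n‖
        ≤ ‖a p‖ * ((∑' p, ‖a p‖) * C * t ^ (m + p)) := by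
          gcongr; exact norm_lowerConv_le ht ha1 hC h (m + p)
      _ = _ := by ring
  have h2 : ∑' x : ℕ × ℕ, a x.1 * (zeroExt a (((m + x.1 : ℕ) : ℤ) - x.2) * A x.2) =
      upperConv a (lowerConv a A) m := by
    rw [hs.tsum_prod]
    refine tsum_congr fun p => ?_
    exact ((hasSum_lowerConv a A (m + p)).mul_left (a p)).tsum_eq
  have hs' := hs.prod_symm
  have h3 : ∀ n : ℕ, ∑' p : ℕ, a p * (zeroExt a (((m + p : ℕ) : ℤ) - n) * A n) =
      A n * κ ((m : ℤ) - n).natAbs := fun n => by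
    rw [← hκ, ← tsum_mul_left]
    refine tsum_congr fun p => ?_
    rw [show ((m + p : ℕ) : ℤ) - n = p + (m - n) by push_cast; ring]
    ring
  rw [← h2, ← (Equiv.prodComm ℕ ℕ).tsum_eq]
  have h4 := hs'.hasSum.prod_fiberwise fun n => (hs'.prod_factor n).hasSum
  simpa only [Prod.swap_prod_mk, h3, Equiv.prodComm_apply, Prod.fst_swap, Prod.snd_swap] using h4

/-- The Wiener-Hopf solution of a semi-infinite Toeplitz system. -/
lemma toeplitz_system_iff {κ a b A f : ℕ → ℂ} {t : ℝ} (ht : 1 ≤ t)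
    (ha : Summable fun p => ‖a p‖ * t ^ p) (hb : Summable fun p => ‖b p‖ * t ^ p)
    (hab : ConvInverse a b)
    (hκ : ∀ j : ℤ, ∑' p : ℕ, a p * zeroExt a (p + j) = κ j.natAbs)
    (hA : Grows t A) (hf : Grows t f) :
    (∀ m : ℕ, ∑' n : ℕ, A n * κ ((m : ℤ) - n).natAbs = f m) ↔
      ∀ m, A m = lowerConv b (upperConv b f) m := by
  have ht0 : 0 ≤ t := by linarith
  have hLA := grows_lowerConv ht (summable_norm_of_weighted ht ha) hA
  simp_rw [fun m => (hasSum_toeplitz ht ha hκ hA m).tsum_eq]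
  rw [← funext_iff, ← funext_iff]
  constructor
  · intro h
    rw [← h, upperConv_upperConv ht0 hab.symm hb ha hLA, lowerConv_lowerConv hab.symm]
  · intro h
    rw [h, lowerConv_lowerConv hab, upperConv_upperConv ht0 hab ha hb hf]

/-! ### Excitation by the other array -/

section Source

variable {ι : Type*} {e : ι → ℕ} {D : ι → ℂ} {M : ℕ → ι → ℂ} {σ t C E : ℝ}

/-- In this section `e q` is the position of the scatterer `q` of the other array, `D q` its
coefficient and `M n q` its effect on row `n`, decaying at rate `σ`. Injectivity of `e` allows
comparison with a sum over all integers, whose value does not depend on `n`. -/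
lemma summable_source_bound (he : Function.Injective e) (ht : 1 ≤ t) (hσ : t < Real.exp σ)
    (n : ℕ) :
    Summable (fun q => t ^ e q * Real.exp (-σ * ((n : ℤ) - e q).natAbs)) ∧
      ∑' q, t ^ e q * Real.exp (-σ * ((n : ℤ) - e q).natAbs) ≤
        (∑' j : ℤ, (t * Real.exp (-σ)) ^ j.natAbs) * t ^ n := by
  have ht0 : 0 ≤ t := by linarith
  have hρ : t * Real.exp (-σ) < 1 := by
    rw [Real.exp_neg, ← div_eq_mul_inv]
    exact (div_lt_one (Real.exp_pos _)).2 hσ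
  have hs := summable_pow_natAbs (ρ := t * Real.exp (-σ)) (by positivity) hρ
  have hinj : Function.Injective fun q => (n : ℤ) - e q := fun q q' h => he (by
    simp only at h; omega)
  have hs1 := hs.comp_injective hinj
  have hle := fun q => pow_mul_exp_natAbs_le (σ := σ) ht n (e q)
  have hs2 : Summable fun q => t ^ e q * Real.exp (-σ * ((n : ℤ) - e q).natAbs) :=
    Summable.of_nonneg_of_le (fun q => by positivity) hle (hs1.mul_left _)
  refine ⟨hs2, (hs2.tsum_le_tsum hle (hs1.mul_left _)).trans ?_⟩
  rw [tsum_mul_left, mul_comm]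
  gcongr
  exact hs1.tsum_le_tsum_of_inj _ hinj (fun _ _ => by positivity) (fun _ => le_rfl) hs

lemma norm_source_le (hC : 0 ≤ C) (hD : ∀ q, ‖D q‖ ≤ C * t ^ e q)
    (hM : ∀ n q, ‖M n q‖ ≤ E * Real.exp (-σ * ((n : ℤ) - e q).natAbs)) (ht : 1 ≤ t)
    (n : ℕ) (q : ι) :
    ‖D q * M n q‖ ≤ C * E * (t ^ e q * Real.exp (-σ * ((n : ℤ) - e q).natAbs)) := by
  have ht0 : 0 ≤ t := by linarith
  rw [norm_mul]
  calc ‖D q‖ * ‖M n q‖ ≤ (C * t ^ e q) * (E * Real.exp (-σ * ((n : ℤ) - e q).natAbs)) :=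
        mul_le_mul (hD q) (hM n q) (norm_nonneg _) (by positivity)
    _ = _ := by ring

lemma summable_source (he : Function.Injective e) (ht : 1 ≤ t) (hσ : t < Real.exp σ)
    (hC : 0 ≤ C) (hD : ∀ q, ‖D q‖ ≤ C * t ^ e q)
    (hM : ∀ n q, ‖M n q‖ ≤ E * Real.exp (-σ * ((n : ℤ) - e q).natAbs)) (n : ℕ) :
    Summable fun q => ‖D q * M n q‖ :=
  Summable.of_nonneg_of_le (fun _ => norm_nonneg _) (norm_source_le hC hD hM ht n)
    ((summable_source_bound he ht hσ n).1.mul_left _)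

lemma tsum_norm_source_le (he : Function.Injective e) (ht : 1 ≤ t) (hσ : t < Real.exp σ)
    (hC : 0 ≤ C) (hE : 0 ≤ E) (hD : ∀ q, ‖D q‖ ≤ C * t ^ e q)
    (hM : ∀ n q, ‖M n q‖ ≤ E * Real.exp (-σ * ((n : ℤ) - e q).natAbs)) (n : ℕ) :
    ∑' q, ‖D q * M n q‖ ≤ C * E * (∑' j : ℤ, (t * Real.exp (-σ)) ^ j.natAbs) * t ^ n := by
  refine ((summable_source he ht hσ hC hD hM n).tsum_le_tsum (norm_source_le hC hD hM ht n)
    ((summable_source_bound he ht hσ n).1.mul_left _)).trans ?_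
  rw [tsum_mul_left, mul_assoc (C * E)]
  gcongr
  exact (summable_source_bound he ht hσ n).2

lemma grows_source (he : Function.Injective e) (ht : 1 ≤ t) (hσ : t < Real.exp σ)
    (hC : 0 ≤ C) (hE : 0 ≤ E) (hD : ∀ q, ‖D q‖ ≤ C * t ^ e q)
    (hM : ∀ n q, ‖M n q‖ ≤ E * Real.exp (-σ * ((n : ℤ) - e q).natAbs)) :
    Grows t fun n => ∑' q, D q * M n q := by
  have ht0 : 0 ≤ t := by linarith
  exact ⟨C * E * ∑' j : ℤ, (t * Real.exp (-σ)) ^ j.natAbs,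
    mul_nonneg (by positivity) (tsum_nonneg fun _ => by positivity), fun n =>
    (norm_tsum_le_tsum_norm (summable_source he ht hσ hC hD hM n)).trans
      (tsum_norm_source_le he ht hσ hC hE hD hM n)⟩

/-- Summing over the scatterers first leaves `O(t ^ (p + n))`, which the weighted summability of `b`
absorbs. -/
lemma summable_prod_source {b : ℕ → ℂ} (he : Function.Injective e) (ht : 1 ≤ t)
    (hσ : t < Real.exp σ) (hC : 0 ≤ C) (hE : 0 ≤ E) (hD : ∀ q, ‖D q‖ ≤ C * t ^ e q)
    (hM : ∀ n q, ‖M n q‖ ≤ E * Real.exp (-σ * ((n : ℤ) - e q).natAbs))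
    (hb : Summable fun p => ‖b p‖ * t ^ p) (n : ℕ) :
    Summable fun x : ι × ℕ => b x.2 * D x.1 * M (x.2 + n) x.1 := by
  have ht0 : 0 ≤ t := by linarith
  suffices h : Summable fun x : ℕ × ι => b x.1 * (D x.2 * M (x.1 + n) x.2) by
    simpa only [mul_assoc] using! h.prod_symm
  have hrow : ∀ p : ℕ, ∑' q, ‖b p * (D q * M (p + n) q)‖ = ‖b p‖ * ∑' q, ‖D q * M (p + n) q‖ :=
    fun p => by simp_rw [norm_mul (b p)]; rw [tsum_mul_left]
  refine Summable.of_norm ((summable_prod_of_nonneg fun x => norm_nonneg _).2 ⟨fun p => ?_, ?_⟩)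
  · simp_rw [norm_mul (b p)]
    exact (summable_source he ht hσ hC hD hM (p + n)).mul_left _
  · simp_rw [hrow]
    refine Summable.of_nonneg_of_le
      (fun p => mul_nonneg (norm_nonneg _) (tsum_nonneg fun n => norm_nonneg _)) (fun p => ?_)
      (hb.mul_right (C * E * (∑' j : ℤ, (t * Real.exp (-σ)) ^ j.natAbs) * t ^ n))
    calc ‖b p‖ * ∑' q, ‖D q * M (p + n) q‖
        ≤ ‖b p‖ * (C * E * (∑' j : ℤ, (t * Real.exp (-σ)) ^ j.natAbs) * t ^ (p + n)) := by
          gcongr; exact tsum_norm_source_le he ht hσ hC hE hD hM (p + n)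
      _ = _ := by ring

lemma upperConv_source {b : ℕ → ℂ} (he : Function.Injective e) (ht : 1 ≤ t)
    (hσ : t < Real.exp σ) (hC : 0 ≤ C) (hE : 0 ≤ E) (hD : ∀ q, ‖D q‖ ≤ C * t ^ e q)
    (hM : ∀ n q, ‖M n q‖ ≤ E * Real.exp (-σ * ((n : ℤ) - e q).natAbs))
    (hb : Summable fun p => ‖b p‖ * t ^ p) (n : ℕ) :
    upperConv b (fun n => ∑' q, D q * M n q) n =
      ∑' q, ∑' p, b p * D q * M (p + n) q := by
  have hs := summable_prod_source he ht hσ hC hE hD hM hb n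
  rw [← Summable.tsum_comm (f := fun (q : ι) (p : ℕ) => b p * D q * M (p + n) q) hs, upperConv]
  refine tsum_congr fun p => ?_
  rw [← tsum_mul_left]
  exact tsum_congr fun q => by rw [mul_assoc, add_comm n p]

/-- The response to the excitation by the other array, as a double series. -/
lemma lowerConv_upperConv_source {b : ℕ → ℂ} (he : Function.Injective e) (ht : 1 ≤ t)
    (hσ : t < Real.exp σ) (hC : 0 ≤ C) (hE : 0 ≤ E) (hD : ∀ q, ‖D q‖ ≤ C * t ^ e q)
    (hM : ∀ n q, ‖M n q‖ ≤ E * Real.exp (-σ * ((n : ℤ) - e q).natAbs))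
    (hb : Summable fun p => ‖b p‖ * t ^ p) (m : ℕ) :
    (Summable fun x : ι × ℕ =>
      ∑ n ∈ Finset.range (m + 1), b (m - n) * b x.2 * D x.1 * M (x.2 + n) x.1) ∧
    lowerConv b (upperConv b fun n => ∑' q, D q * M n q) m =
      ∑' q, ∑' p, ∑ n ∈ Finset.range (m + 1), b (m - n) * b p * D q * M (p + n) q := by
  have hs : ∀ n, Summable fun x : ι × ℕ => b (m - n) * b x.2 * D x.1 * M (x.2 + n) x.1 :=
    fun n => by
      simpa only [mul_assoc] using
        (summable_prod_source he ht hσ hC hE hD hM hb n).mul_left (b (m - n))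
  have hS : Summable fun x : ι × ℕ =>
      ∑ n ∈ Finset.range (m + 1), b (m - n) * b x.2 * D x.1 * M (x.2 + n) x.1 :=
    summable_sum fun n _ => hs n
  refine ⟨hS, ?_⟩
  rw [← hS.tsum_prod, Summable.tsum_finsetSum fun n _ => hs n, lowerConv]
  refine Finset.sum_congr rfl fun n _ => ?_
  rw [(hs n).tsum_prod, upperConv_source he ht hσ hC hE hD hM hb n, ← tsum_mul_left]
  refine tsum_congr fun q => ?_
  rw [← tsum_mul_left]
  exact tsum_congr fun p => by ring

end Source

/-! ### Fourier and Laurent coefficients -/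

lemma fourier_eq_zpow (n : ℤ) (x : AddCircle (2 * Real.pi)) :
    fourier n x = (AddCircle.toCircle x : ℂ) ^ n := by
  rw [fourier_apply, AddCircle.toCircle_zsmul, Circle.coe_zpow]

/-- The exponents `e i` may repeat, so that the lemma applies directly to products of series,
indexed by pairs. -/
lemma fourierCoeff_tsum [Fact (0 < 2 * Real.pi)] {ι : Type*} [Countable ι] {c : ι → ℂ}
    (hc : Summable fun i => ‖c i‖) (e : ι → ℤ) (j : ℤ) :
    fourierCoeff (fun x : AddCircle (2 * Real.pi) => ∑' i, c i * fourier (e i) x) j =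
      ∑' i, if e i = j then c i else 0 := by
  have hnorm : ∀ (n : ℤ) (x : AddCircle (2 * Real.pi)), ‖fourier n x‖ = 1 := fun n x =>
    Circle.norm_coe _
  have hcont : ∀ i, Continuous fun x : AddCircle (2 * Real.pi) =>
      fourier (-j) x * (c i * fourier (e i) x) := fun i => by fun_prop
  have h := MeasureTheory.integral_tsum_of_summable_integral_norm
    (μ := AddCircle.haarAddCircle (T := 2 * Real.pi))
    (F := fun (i : ι) (x : AddCircle (2 * Real.pi)) =>
      fourier (-j) x * (c i * fourier (e i) x))
    (fun i => (hcont i).integrable_of_hasCompactSupport (HasCompactSupport.of_compactSpace _))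
    (by simpa only [norm_mul, hnorm, one_mul, mul_one, MeasureTheory.integral_const,
      MeasureTheory.probReal_univ, one_smul] using hc)
  rw [fourierCoeff]
  simp_rw [smul_eq_mul, ← tsum_mul_left]
  rw [← h]
  refine tsum_congr fun i => ?_
  have h1 := congrFun (fourierCoeff_fourier (T := 2 * Real.pi) (e i)) j
  have h2 := fourierCoeff.const_mul (T := 2 * Real.pi) (fun x => fourier (e i) x) (c i) j
  rw [fourierCoeff] at h2
  simp only [smul_eq_mul] at h2
  rw [h2, h1, Pi.single_apply]
  simp [eq_comm]

/-- Two absolutely convergent trigonometric sums with the same value on the unit circle have the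
same coefficients. -/
lemma coeff_unique {ι ι' : Type*} [Countable ι] [Countable ι'] {c : ι → ℂ} {d : ι' → ℂ}
    (hc : Summable fun i => ‖c i‖) (hd : Summable fun i => ‖d i‖) (e : ι → ℤ) (g : ι' → ℤ)
    (h : ∀ z : ℂ, ‖z‖ = 1 → ∑' i, c i * z ^ e i = ∑' i, d i * z ^ g i) (j : ℤ) :
    (∑' i, if e i = j then c i else 0) = ∑' i, if g i = j then d i else 0 := by
  have := Fact.mk Real.two_pi_pos
  rw [← fourierCoeff_tsum hc, ← fourierCoeff_tsum hd]
  congr 1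
  funext x
  simp_rw [fourier_eq_zpow]
  exact h _ (Circle.norm_coe _)

lemma circleIntegral_eq_of_annulus {R : ℝ} (hR : 1 < R) {D : ℂ → ℂ}
    (hD : DifferentiableOn ℂ D {z | R⁻¹ < ‖z‖ ∧ ‖z‖ < R}) {r r' : ℝ} (hr : R⁻¹ < r)
    (hrr' : r ≤ r') (hr' : r' < R) (n : ℤ) :
    (∮ z in C(0, r'), z ^ n * D z) = ∮ z in C(0, r), z ^ n * D z := by
  have hR0 : 0 < R := by linarith
  have hr0 : 0 < r := (inv_pos.2 hR0).trans hr
  have hopen : IsOpen {z : ℂ | R⁻¹ < ‖z‖ ∧ ‖z‖ < R} :=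
    (isOpen_lt continuous_const continuous_norm).inter
      (isOpen_lt continuous_norm continuous_const)
  have hd : DifferentiableOn ℂ (fun z => z ^ n * D z) {z | R⁻¹ < ‖z‖ ∧ ‖z‖ < R} := by
    refine DifferentiableOn.mul (fun z hz => ?_) hD
    refine (differentiableAt_zpow.2 (Or.inl ?_)).differentiableWithinAt
    exact norm_pos_iff.1 ((inv_pos.2 hR0).trans hz.1)
  refine Complex.circleIntegral_eq_of_differentiable_on_annulus_off_countable hr0 hrr'
    Set.countable_empty (hd.continuousOn.mono fun z hz => ?_) fun z hz =>
      hd.differentiableAt (hopen.mem_nhds ?_)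
  · simp only [Set.mem_sdiff, mem_closedBall_zero_iff, mem_ball_zero_iff, not_lt] at hz
    exact ⟨hr.trans_le hz.2, hz.1.trans_lt hr'⟩
  · simp only [Set.mem_sdiff, mem_closedBall_zero_iff, mem_ball_zero_iff, not_le] at hz
    exact ⟨hr.trans hz.1.2, hz.1.1.trans hr'⟩

/-- Laurent expansion on an annulus around the unit circle. -/
theorem exists_laurent {R : ℝ} (hR : 1 < R) {D : ℂ → ℂ}
    (hD : DifferentiableOn ℂ D {z | R⁻¹ < ‖z‖ ∧ ‖z‖ < R}) :
    ∃ c : ℤ → ℂ, (∀ r, R⁻¹ < r → r < R → ∃ M : ℝ, 0 ≤ M ∧ ∀ n, ‖c n‖ ≤ M * r ^ (-n)) ∧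
      (Summable fun n => ‖c n‖) ∧ ∀ z : ℂ, ‖z‖ = 1 → HasSum (fun n => c n * z ^ n) (D z) := by
  have := Fact.mk Real.two_pi_pos
  have hR0 : 0 < R := by linarith
  have hR1 : R⁻¹ < 1 := inv_lt_one_of_one_lt₀ hR
  set c : ℤ → ℂ := fun n => (2 * Real.pi * Complex.I : ℂ)⁻¹ •
    ∮ z in C(0, 1), z ^ (-n - 1) * D z with hc
  have hcr : ∀ r, R⁻¹ < r → r < R → ∀ n, c n = (2 * Real.pi * Complex.I : ℂ)⁻¹ •
      ∮ z in C(0, r), z ^ (-n - 1) * D z := fun r hr hr' n => by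
    rcases le_total r 1 with h | h
    · rw [hc]; simp only; rw [circleIntegral_eq_of_annulus hR hD hr h hR]
    · rw [circleIntegral_eq_of_annulus hR hD hR1 h hr']
  have hbound : ∀ r, R⁻¹ < r → r < R → ∃ M : ℝ, 0 ≤ M ∧ ∀ n, ‖c n‖ ≤ M * r ^ (-n) := by
    intro r hr hr'
    have hr0 : 0 < r := (inv_pos.2 hR0).trans hr
    have hcont : ContinuousOn D (Metric.sphere 0 r) := hD.continuousOn.mono fun z hz => by
      rw [mem_sphere_zero_iff_norm] at hz
      exact ⟨by rw [hz]; exact hr, by rw [hz]; exact hr'⟩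
    obtain ⟨M, hM⟩ := (isCompact_sphere (0 : ℂ) r).exists_bound_of_continuousOn hcont
    have hM0 : 0 ≤ M := (norm_nonneg (D r)).trans (hM r (by simp [abs_of_pos hr0]))
    refine ⟨M, hM0, fun n => ?_⟩
    rw [hcr r hr hr' n]
    refine (circleIntegral.norm_two_pi_i_inv_smul_integral_le_of_norm_le_const hr0.le
      (C := r ^ (-n - 1) * M) fun z hz => ?_).trans_eq ?_
    · rw [norm_mul, norm_zpow, mem_sphere_zero_iff_norm.1 hz]
      gcongr
      exact hM z hz
    · rw [← mul_assoc, mul_comm r, zpow_sub_one₀ hr0.ne', inv_mul_cancel_right₀ hr0.ne', mul_comm]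
  have hsum : Summable fun n => ‖c n‖ := by
    -- The circle of radius `u > 1` controls the coefficients with `n ≥ 0`, the circle of radius
    -- `u⁻¹` those with `n ≤ 0`.
    obtain ⟨u, hu1, huR⟩ := exists_between hR
    have hu0 : 0 < u := by linarith
    obtain ⟨M, hM0, hM⟩ := hbound u (hR1.trans hu1) huR
    obtain ⟨N, hN0, hN⟩ := hbound u⁻¹ ((inv_lt_inv₀ hR0 hu0).2 huR)
      ((inv_lt_one_of_one_lt₀ hu1).trans hR)
    refine Summable.of_nonneg_of_le (fun n => norm_nonneg _) (fun n => ?_)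
      ((summable_pow_natAbs (ρ := u⁻¹) (by positivity) (inv_lt_one_of_one_lt₀ hu1)).mul_left
        (M + N))
    rcases Int.natAbs_eq n with h | h
    · calc ‖c n‖ ≤ M * u ^ (-n) := hM n
        _ = M * u⁻¹ ^ n.natAbs := by
          rw [← zpow_natCast, ← h, inv_zpow']
        _ ≤ _ := by gcongr; linarith
    · calc ‖c n‖ ≤ N * u⁻¹ ^ (-n) := hN n
        _ = N * u⁻¹ ^ n.natAbs := by
          rw [← zpow_natCast, show ((n.natAbs : ℤ)) = -n by omega]
        _ ≤ _ := by gcongr; linarith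
  refine ⟨c, hbound, hsum, fun z hz => ?_⟩
  have hmem : ∀ x : AddCircle (2 * Real.pi),
      (AddCircle.toCircle x : ℂ) ∈ {z : ℂ | R⁻¹ < ‖z‖ ∧ ‖z‖ < R} := fun x => by
    simp only [Set.mem_ofPred_eq, Circle.norm_coe]
    exact ⟨hR1, hR⟩
  let f : C(AddCircle (2 * Real.pi), ℂ) := ⟨fun x => D (AddCircle.toCircle x : ℂ),
    hD.continuousOn.comp_continuous
      (continuous_induced_dom.comp AddCircle.continuous_toCircle) hmem⟩
  -- On the unit circle the Laurent coefficients are Fourier coefficients; being summable, they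
  -- represent the function at every point.
  have hcoef : ∀ n, fourierCoeff f n = c n := fun n => by
    rw [fourierCoeff_eq_intervalIntegral _ _ 0, hc]
    simp only [circleIntegral, zero_add, deriv_circleMap, smul_eq_mul]
    rw [← intervalIntegral.integral_const_mul]
    rw [← intervalIntegral.integral_smul]
    refine intervalIntegral.integral_congr fun θ _ => ?_
    have h1 : (AddCircle.toCircle (θ : AddCircle (2 * Real.pi)) : ℂ) = circleMap 0 1 θ := by
      rw [AddCircle.toCircle_apply_mk, div_self Real.two_pi_pos.ne', one_mul, Circle.coe_exp]
      simp [circleMap]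
    have h0 : circleMap 0 1 θ ≠ 0 := circleMap_ne_center one_ne_zero
    have hf : f (θ : AddCircle (2 * Real.pi)) = D (circleMap 0 1 θ) := by rw [← h1]; rfl
    simp only [fourier_eq_zpow, h1, hf]
    rw [zpow_sub_one₀ h0]
    simp only [Complex.real_smul]
    push_cast
    have : (Real.pi : ℂ) ≠ 0 := Complex.ofReal_ne_zero.2 Real.pi_ne_zero
    field_simp
  have hx : ∃ x : AddCircle (2 * Real.pi), (AddCircle.toCircle x : ℂ) = z := by
    refine ⟨(Complex.arg z : ℝ), ?_⟩
    rw [AddCircle.toCircle_apply_mk, div_self Real.two_pi_pos.ne', one_mul, Circle.coe_exp]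
    have := Complex.norm_mul_exp_arg_mul_I z
    rwa [hz, Complex.ofReal_one, one_mul] at this
  obtain ⟨x, rfl⟩ := hx
  have h : HasSum _ (D _) := has_pointwise_sum_fourier_series_of_summable (f := f)
    (by rw [funext hcoef]; exact hsum.of_norm) x
  simpa only [hcoef, fourier_eq_zpow, smul_eq_mul] using h

/-! ### Taylor coefficients -/

lemma hasSum_taylor {f : ℂ → ℂ} {R : ℝ} (hf : DifferentiableOn ℂ f (Metric.ball 0 R)) {z : ℂ}
    (hz : ‖z‖ < R) :
    HasSum (fun n : ℕ => iteratedDeriv n f 0 / (n.factorial : ℂ) * z ^ n) (f z) := by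
  have h := Complex.hasSum_taylorSeries_on_ball hf (mem_ball_zero_iff.2 hz)
  have e : (fun n : ℕ => iteratedDeriv n f 0 / (n.factorial : ℂ) * z ^ n) =
      fun n : ℕ => (n.factorial : ℂ)⁻¹ • (z - 0) ^ n • iteratedDeriv n f 0 := by
    funext n
    rw [smul_eq_mul, smul_eq_mul, sub_zero]
    ring
  rw [e]
  exact h

lemma summable_taylor {f : ℂ → ℂ} {R t : ℝ} (hf : DifferentiableOn ℂ f (Metric.ball 0 R))
    (ht : 0 ≤ t) (htR : t < R) :
    Summable fun n : ℕ => ‖iteratedDeriv n f 0 / (n.factorial : ℂ)‖ * t ^ n := by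
  have h := (hasSum_taylor hf (z := (t : ℂ)) (by rwa [Complex.norm_real, Real.norm_of_nonneg ht]))
  simpa only [norm_mul, norm_pow, Complex.norm_real, Real.norm_of_nonneg ht] using h.summable.norm

/-- The Taylor coefficients of reciprocal functions are inverse to each other. -/
lemma convInverse_of_mul_eq_one {a b : ℕ → ℂ} {f g : ℂ → ℂ}
    (ha : Summable fun n => ‖a n‖) (hb : Summable fun n => ‖b n‖)
    (hf : ∀ z : ℂ, ‖z‖ = 1 → HasSum (fun n => a n * z ^ n) (f z))
    (hg : ∀ z : ℂ, ‖z‖ = 1 → HasSum (fun n => b n * z ^ n) (g z))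
    (h : ∀ z : ℂ, ‖z‖ = 1 → f z * g z = 1) : ConvInverse a b := by
  intro n
  -- The product series, indexed by pairs, is compared with the one-term series `1`.
  have key := coeff_unique (c := fun x : ℕ × ℕ => a x.1 * b x.2) (d := fun _ : Unit => (1 : ℂ))
    (ha.mul_norm hb) (hasSum_fintype _).summable (fun x => ((x.1 + x.2 : ℕ) : ℤ)) (fun _ => 0)
    (fun z hz => by
      have h1 := tsum_mul_tsum_of_summable_norm (f := fun n => a n * z ^ n)
        (g := fun n => b n * z ^ n) (by simpa [hz] using ha) (by simpa [hz] using hb)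
      rw [(hf z hz).tsum_eq, (hg z hz).tsum_eq, h z hz] at h1
      simp only [tsum_fintype, zpow_zero, mul_one, Finset.univ_unique, Finset.sum_const, Finset.card_singleton,
        one_smul]
      rw [h1]
      refine tsum_congr fun x => ?_
      rw [zpow_natCast, pow_add]
      ring) n
  simp only [tsum_fintype, Nat.cast_inj, Finset.univ_unique, Finset.sum_const, Finset.card_singleton,
    one_smul] at key
  rw [tsum_eq_sum (s := Finset.HasAntidiagonal.antidiagonal n) (fun x hx => if_neg fun hx' =>
    hx (Finset.HasAntidiagonal.mem_antidiagonal.2 hx'))] at key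
  rw [Finset.sum_congr rfl (g := fun x : ℕ × ℕ => if x.1 + x.2 = n then a x.1 * b x.2 else 0)
    fun x hx => (if_pos (Finset.HasAntidiagonal.mem_antidiagonal.1 hx)).symm, key]
  simp only [eq_comm (a := (0 : ℤ)), Nat.cast_eq_zero]

/-- The Laurent coefficients of `f(z) f(1/z)`. -/
lemma tsum_mul_zeroExt {a κ : ℕ → ℂ} {f K : ℂ → ℂ} (ha : Summable fun n => ‖a n‖)
    (hκ : Summable fun j : ℤ => ‖κ j.natAbs‖)
    (hf : ∀ z : ℂ, ‖z‖ = 1 → HasSum (fun n => a n * z ^ n) (f z))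
    (hK : ∀ z : ℂ, ‖z‖ = 1 → HasSum (fun j : ℤ => κ j.natAbs * z ^ j) (K z))
    (h : ∀ z : ℂ, ‖z‖ = 1 → K z = f z * f z⁻¹) (j : ℤ) :
    ∑' p : ℕ, a p * zeroExt a (p + j) = κ j.natAbs := by
  have key := coeff_unique (c := fun x : ℕ × ℕ => a x.1 * a x.2) (d := fun j : ℤ => κ j.natAbs)
    (ha.mul_norm ha) hκ (fun x => (x.2 : ℤ) - x.1) (fun j => j)
    (fun z hz => by
      have hz' : ‖z⁻¹‖ = 1 := by rw [norm_inv, hz, inv_one]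
      have hz0 : z ≠ 0 := norm_pos_iff.1 (by rw [hz]; exact one_pos)
      have h1 := tsum_mul_tsum_of_summable_norm (f := fun n => a n * z⁻¹ ^ n)
        (g := fun n => a n * z ^ n) (by simpa [hz] using ha) (by simpa [hz] using ha)
      rw [(hf z hz).tsum_eq, (hf z⁻¹ hz').tsum_eq, mul_comm, ← h z hz] at h1
      rw [(hK z hz).tsum_eq, h1]
      refine tsum_congr fun x => ?_
      rw [zpow_sub₀ hz0, zpow_natCast, zpow_natCast, inv_pow]
      ring) j
  rw [tsum_ite_eq] at key
  rw [← key]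
  have hs : Summable fun x : ℕ × ℕ => if (x.2 : ℤ) - x.1 = j then a x.1 * a x.2 else 0 :=
    Summable.of_norm (Summable.of_nonneg_of_le (fun x => norm_nonneg _)
      (fun x => by split_ifs <;> simp [mul_nonneg]) (ha.mul_norm ha))
  rw [hs.tsum_prod]
  refine tsum_congr fun p => ?_
  rw [zeroExt]
  split_ifs with hp
  -- For fixed `p` only `q = p + j` contributes, provided it is nonnegative.
  · rw [tsum_eq_single ((p + j).toNat) (fun q hq => if_neg fun hq' => hq (by simp only at hq'; omega)),
      if_pos (by simp only; omega)]
  · rw [mul_zero]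
    refine ((tsum_congr fun q => if_neg ?_).trans tsum_zero).symm
    simp only
    omega

/-! ### The kernel and its factorisation -/

/-- The Laurent coefficients of the kernel, indexed by the absolute value of the exponent. -/
def kernelCoeff (k : ℂ) (s a : ℝ) (l : ℕ) : ℂ :=
  if l = 0 then hankelH (k * a) else hankelH (k * s * (l : ℕ))

lemma kernelCoeff_pnat (k : ℂ) (s a : ℝ) (l : ℕ+) :
    kernelCoeff k s a l = hankelH (k * s * (l : ℕ)) := if_neg l.ne_zero

lemma exists_norm_kernelCoeff_le {k : ℂ} {s : ℝ} (a : ℝ) (h : 0 < k.im * s) :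
    ∃ C : ℝ, 0 ≤ C ∧ ∀ l : ℕ,
      ‖kernelCoeff k s a l‖ ≤ C * (Real.exp (k.im * s))⁻¹ ^ l := by
  obtain ⟨C, hC, hle⟩ := exists_norm_hankelH_le h
  refine ⟨max C ‖hankelH (k * a)‖, le_max_of_le_left hC, fun l => ?_⟩
  rw [kernelCoeff]
  split_ifs with hl
  · subst hl
    simp
  · have him : (k * s * (l : ℕ)).im = l * (k.im * s) := by
      simp [Complex.mul_im]
      ring
    have hl1 : (1 : ℝ) ≤ l := by exact_mod_cast Nat.one_le_iff_ne_zero.2 hl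
    refine (hle _ (by rw [him]; nlinarith)).trans ?_
    rw [him, ← Real.exp_neg, ← Real.exp_nat_mul, mul_neg]
    gcongr
    exact le_max_left _ _

lemma summable_kernelCoeff {k : ℂ} {s : ℝ} (a : ℝ) (h : 0 < k.im * s) {u : ℝ} (hu0 : 0 ≤ u)
    (hu : u < Real.exp (k.im * s)) : Summable fun l => ‖kernelCoeff k s a l‖ * u ^ l := by
  obtain ⟨C, hC, hle⟩ := exists_norm_kernelCoeff_le a h
  refine Summable.of_nonneg_of_le (fun l => by positivity) (fun l => ?_)
    ((summable_geometric_of_lt_one (r := u / Real.exp (k.im * s)) (by positivity)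
      ((div_lt_one (Real.exp_pos _)).2 hu)).mul_left C)
  calc ‖kernelCoeff k s a l‖ * u ^ l ≤ C * (Real.exp (k.im * s))⁻¹ ^ l * u ^ l := by
        gcongr; exact hle l
    _ = C * (u / Real.exp (k.im * s)) ^ l := by rw [div_eq_mul_inv, mul_pow]; ring

lemma summable_kernelCoeff_int {k : ℂ} {s : ℝ} (a : ℝ) (h : 0 < k.im * s) :
    Summable fun j : ℤ => ‖kernelCoeff k s a j.natAbs‖ := by
  rw [summable_int_iff_summable_nat_and_neg]
  simpa using summable_kernelCoeff a h zero_le_one (Real.one_lt_exp_iff.2 h)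

lemma hasSum_kernel {k : ℂ} {s : ℝ} (a : ℝ) (h : 0 < k.im * s) {z : ℂ} (hz : ‖z‖ = 1) :
    HasSum (fun j : ℤ => kernelCoeff k s a j.natAbs * z ^ j) (kernel k s a z) := by
  have hs : Summable fun j : ℤ => kernelCoeff k s a j.natAbs * z ^ j :=
    Summable.of_norm (by simpa [hz] using summable_kernelCoeff_int a h)
  have hs1 : Summable fun n : ℕ+ => kernelCoeff k s a n * z ^ (n : ℕ) :=
    hs.comp_injective (i := fun n : ℕ+ => ((n : ℕ) : ℤ)) fun m n hmn => by simpa using hmn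
  have hs2 : Summable fun n : ℕ+ => kernelCoeff k s a n * z⁻¹ ^ (n : ℕ) := by
    have h1 := hs.comp_injective (i := fun n : ℕ+ => (-(n : ℕ) : ℤ))
      fun m n hmn => by simpa using hmn
    simpa [Function.comp_def] using h1
  have key := tsum_int_eq_zero_add_tsum_pnat hs
  have hk : kernel k s a z = ∑' j : ℤ, kernelCoeff k s a j.natAbs * z ^ j := by
    rw [key]
    simp only [Int.natAbs_zero, zpow_zero, mul_one, Int.natAbs_neg, Int.natAbs_natCast,
      zpow_natCast, zpow_neg, ← inv_pow]
    rw [kernel, add_assoc, ← hs1.tsum_add hs2]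
    congr 1
    exact tsum_congr fun l => by rw [kernelCoeff_pnat]; ring
  rw [hk]
  exact hs.hasSum

lemma kernel_inv (k : ℂ) (s a : ℝ) (z : ℂ) : kernel k s a z⁻¹ = kernel k s a z := by
  unfold kernel
  simp_rw [inv_inv, add_comm]

lemma annulus_eq (k : ℂ) (s : ℝ) :
    annulus k s = {z | (Real.exp (k.im * s))⁻¹ < ‖z‖ ∧ ‖z‖ < Real.exp (k.im * s)} := by
  rw [← Real.exp_neg]
  rfl

lemma isOpen_annulus (k : ℂ) (s : ℝ) : IsOpen (annulus k s) :=
  (isOpen_lt continuous_const continuous_norm).inter (isOpen_lt continuous_norm continuous_const)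

lemma ne_zero_of_mem_annulus {k : ℂ} {s : ℝ} {z : ℂ} (hz : z ∈ annulus k s) : z ≠ 0 :=
  norm_pos_iff.1 ((Real.exp_pos _).trans hz.1)

lemma inv_mem_annulus {k : ℂ} {s : ℝ} {z : ℂ} (hz : z ∈ annulus k s) : z⁻¹ ∈ annulus k s := by
  have h0 : 0 < ‖z‖ := norm_pos_iff.2 (ne_zero_of_mem_annulus hz)
  rw [annulus_eq] at hz ⊢
  refine ⟨?_, ?_⟩ <;> rw [norm_inv]
  · exact (inv_lt_inv₀ (Real.exp_pos _) h0).2 hz.2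
  · exact inv_lt_of_inv_lt₀ (Real.exp_pos _) hz.1

lemma mem_annulus_of_norm_eq_one {k : ℂ} {s : ℝ} (h : 0 < k.im * s) {z : ℂ} (hz : ‖z‖ = 1) :
    z ∈ annulus k s := by
  refine ⟨?_, ?_⟩ <;> rw [hz]
  · rw [Real.exp_neg]
    exact inv_lt_one_of_one_lt₀ (Real.one_lt_exp_iff.2 h)
  · exact Real.one_lt_exp_iff.2 h

lemma exp_mem_annulus_iff {k : ℂ} {s : ℝ} {w : ℂ} :
    Complex.exp w ∈ annulus k s ↔ -(k.im * s) < w.re ∧ w.re < k.im * s := by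
  simp [annulus, Complex.norm_exp]

lemma differentiableOn_kernel {k : ℂ} {s : ℝ} (a : ℝ) (h : 0 < k.im * s) :
    DifferentiableOn ℂ (kernel k s a) (annulus k s) := by
  intro z hz
  have hz' := inv_mem_annulus hz
  -- A bound `u` for both `‖z‖` and `‖z⁻¹‖` dominates the two halves of the series at once near `z`.
  obtain ⟨u, hu1, hu2⟩ := exists_between (max_lt hz.2 hz'.2)
  rw [max_lt_iff] at hu1
  have hu0 : 0 ≤ u := (norm_nonneg z).trans hu1.1.le
  set U : Set ℂ := {w | w ≠ 0 ∧ ‖w‖ < u ∧ ‖w⁻¹‖ < u} with hU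
  have hne : U ⊆ {w | w ≠ 0} := fun w hw => hw.1
  have hUo : IsOpen U := by
    have h1 : IsOpen {w : ℂ | w ≠ 0} := isOpen_ne
    have h2 : ContinuousOn (fun w : ℂ => ‖w⁻¹‖) {w | w ≠ 0} :=
      (continuousOn_inv₀ (G₀ := ℂ)).norm
    have h3 := h2.isOpen_inter_preimage h1 (isOpen_Iio (a := u))
    have h4 : IsOpen {w : ℂ | ‖w‖ < u} := isOpen_lt continuous_norm continuous_const
    convert h4.inter h3 using 1
    ext w
    simp only [hU, Set.mem_ofPred_eq, Set.mem_inter_iff, Set.mem_preimage, Set.mem_Iio]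
    tauto
  have hsum : Summable fun l : ℕ+ => 2 * (‖kernelCoeff k s a l‖ * u ^ (l : ℕ)) :=
    ((summable_kernelCoeff a h hu0 hu2).comp_injective PNat.coe_injective).mul_left 2
  have hd : DifferentiableOn ℂ (fun w => ∑' l : ℕ+, (w ^ (l : ℕ) + (w⁻¹) ^ (l : ℕ)) *
      hankelH (k * s * (l : ℕ))) U := by
    refine Complex.differentiableOn_tsum_of_summable_norm hsum (fun l => ?_) hUo fun l w hw => ?_
    · refine DifferentiableOn.mul_const (DifferentiableOn.add (differentiableOn_pow _) ?_) _
      exact (differentiableOn_inv.mono hne).pow _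
    · rw [← kernelCoeff_pnat k s a l, norm_mul]
      have h1 : ‖w ^ (l : ℕ) + w⁻¹ ^ (l : ℕ)‖ ≤ 2 * u ^ (l : ℕ) := by
        refine (norm_add_le _ _).trans ?_
        rw [norm_pow, norm_pow, two_mul]
        gcongr
        exacts [hw.2.1.le, hw.2.2.le]
      calc _ ≤ 2 * u ^ (l : ℕ) * ‖kernelCoeff k s a l‖ := by gcongr
        _ = _ := by ring
  have hzU : z ∈ U := ⟨ne_zero_of_mem_annulus hz, hu1.1, hu1.2⟩
  exact ((hd.const_add _).differentiableAt (hUo.mem_nhds hzU)).differentiableWithinAt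

/-- A power series with fast decaying coefficients. -/
lemma differentiableOn_tsum_pow {c : ℕ → ℂ} {R : ℝ}
    (hc : ∀ r, 0 ≤ r → r < R → Summable fun n => ‖c n‖ * r ^ n) :
    DifferentiableOn ℂ (fun z => ∑' n : ℕ, c n * z ^ n) (Metric.ball 0 R) := by
  intro z hz
  obtain ⟨r, hr, hrR⟩ := exists_between (mem_ball_zero_iff.1 hz)
  have hr0 : 0 ≤ r := (norm_nonneg z).trans hr.le
  have hd : DifferentiableOn ℂ (fun z => ∑' n : ℕ, c n * z ^ n) (Metric.ball 0 r) := by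
    refine Complex.differentiableOn_tsum_of_summable_norm (hc r hr0 hrR)
      (fun n => (differentiableOn_pow n).const_mul _) Metric.isOpen_ball fun n w hw => ?_
    rw [norm_mul, norm_pow]
    gcongr
    exact (mem_ball_zero_iff.1 hw).le
  exact (hd.differentiableAt (Metric.isOpen_ball.mem_nhds
    (mem_ball_zero_iff.2 hr))).differentiableWithinAt

/-- Additive splitting, on the unit circle, of a function that is odd under `z ↦ 1 / z`. -/
lemma exists_odd_splitting {R : ℝ} (hR : 1 < R) {D : ℂ → ℂ}
    (hD : DifferentiableOn ℂ D {z | R⁻¹ < ‖z‖ ∧ ‖z‖ < R})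
    (hodd : ∀ z : ℂ, ‖z‖ = 1 → D z⁻¹ = -D z) :
    ∃ Q : ℂ → ℂ, DifferentiableOn ℂ Q (Metric.ball 0 R) ∧
      ∀ z : ℂ, ‖z‖ = 1 → D z = z * Q z - z⁻¹ * Q z⁻¹ := by
  obtain ⟨c, hbound, hsum, hc⟩ := exists_laurent hR hD
  have hR0 : 0 < R := by linarith
  have hanti : ∀ n, c (-n) = -c n := fun n => by
    have key := coeff_unique (c := c) (d := fun n => -c n) hsum (by simpa using hsum)
      (fun n => -n) (fun n => n) (fun z hz => by
        have hz' : ‖z⁻¹‖ = 1 := by rw [norm_inv, hz, inv_one]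
        have h1 := (hc z⁻¹ hz').tsum_eq
        rw [hodd z hz, ← (hc z hz).neg.tsum_eq] at h1
        simpa only [inv_zpow', neg_mul] using h1) n
    simp_rw [neg_eq_iff_eq_neg] at key
    rwa [tsum_ite_eq, tsum_ite_eq] at key
  -- For the logarithmic derivative of the kernel this says that the winding number vanishes, which
  -- is what allows a factorisation without a power of `z`.
  have hc0 : c 0 = 0 := by
    have := hanti 0
    rw [neg_zero] at this
    exact self_eq_neg.1 this
  have hdec : ∀ r, 0 ≤ r → r < R → Summable fun n : ℕ => ‖c (n + 1)‖ * r ^ n := by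
    intro r hr0 hr
    obtain ⟨u, hu1, hu2⟩ := exists_between (max_lt hR hr)
    rw [max_lt_iff] at hu1
    have hu0 : 0 < u := by linarith
    obtain ⟨M, hM0, hM⟩ := hbound u ((inv_lt_one_of_one_lt₀ hR).trans hu1.1) hu2
    refine Summable.of_nonneg_of_le (fun n => by positivity) (fun n => ?_)
      ((summable_geometric_of_lt_one (r := r / u) (by positivity)
        ((div_lt_one hu0).2 hu1.2)).mul_left M)
    calc ‖c (n + 1)‖ * r ^ n ≤ M * u ^ (-((n : ℤ) + 1)) * r ^ n := by gcongr; exact hM _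
      _ ≤ M * u ^ (-(n : ℤ)) * r ^ n := by
        gcongr
        · exact hu1.1.le
        · omega
      _ = M * (r / u) ^ n := by rw [zpow_neg, zpow_natCast, div_pow]; ring
  refine ⟨fun z => ∑' n : ℕ, c (n + 1) * z ^ n, differentiableOn_tsum_pow hdec,
    fun z hz => ?_⟩
  have hz0 : z ≠ 0 := norm_pos_iff.1 (by rw [hz]; exact one_pos)
  have hs := (hc z hz).summable
  have key := tsum_int_eq_zero_add_tsum_pnat hs
  rw [(hc z hz).tsum_eq, hc0, zero_mul, zero_add, tsum_pnat_eq_tsum_succ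
    (f := fun n : ℕ => c n * z ^ (n : ℤ)), tsum_pnat_eq_tsum_succ
    (f := fun n : ℕ => c (-(n : ℤ)) * z ^ (-(n : ℤ)))] at key
  rw [key, sub_eq_add_neg, ← neg_mul, ← tsum_mul_left, ← tsum_mul_left]
  congr 1
  · refine tsum_congr fun n => ?_
    push_cast
    rw [zpow_add_one₀ hz0, zpow_natCast]
    ring
  · refine tsum_congr fun n => ?_
    rw [hanti]
    push_cast
    rw [zpow_neg, zpow_add_one₀ hz0, zpow_natCast, mul_inv, inv_pow]
    ring

/-- The Wiener-Hopf factorisation of the kernel. -/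
theorem exists_isPlusFactor {k : ℂ} {s a : ℝ} (h : 0 < k.im * s)
    (hK : ∀ z ∈ annulus k s, kernel k s a z ≠ 0) : ∃ Kp : ℂ → ℂ, IsPlusFactor k s a Kp := by
  set R := Real.exp (k.im * s) with hRdef
  have hR : 1 < R := Real.one_lt_exp_iff.2 h
  have hKd := differentiableOn_kernel a h
  have hopen := isOpen_annulus k s
  have hKat : ∀ z ∈ annulus k s, HasDerivAt (kernel k s a) (deriv (kernel k s a) z) z :=
    fun z hz => (hKd.differentiableAt (hopen.mem_nhds hz)).hasDerivAt
  set D : ℂ → ℂ := fun z => z * deriv (kernel k s a) z / kernel k s a z with hDdef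
  have hD : DifferentiableOn ℂ D (annulus k s) :=
    (differentiableOn_id.mul (hKd.deriv hopen)).div hKd hK
  have hodd : ∀ z ∈ annulus k s, D z⁻¹ = -D z := fun z hz => by
    -- Differentiating `K(1/z) = K(z)` gives the oddness.
    have hz0 := ne_zero_of_mem_annulus hz
    have h1 : HasDerivAt (fun w => kernel k s a w⁻¹)
        (deriv (kernel k s a) z⁻¹ * (-(z ^ 2)⁻¹)) z :=
      (hKat z⁻¹ (inv_mem_annulus hz)).comp z (hasDerivAt_inv hz0)
    simp_rw [kernel_inv] at h1
    have h2 := h1.unique (hKat z hz)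
    have h3 := hK z hz
    rw [hDdef]
    simp only
    rw [kernel_inv, ← h2]
    field_simp
  obtain ⟨Q, hQ, hsplit⟩ := exists_odd_splitting hR (by rwa [annulus_eq] at hD)
    fun z hz => hodd z (mem_annulus_of_norm_eq_one h hz)
  obtain ⟨E, hE⟩ := hQ.isExactOn_ball
  -- the strip that covers the annulus
  set S : Set ℂ := {w | -(k.im * s) < w.re ∧ w.re < k.im * s} with hS
  have hSo : IsOpen S := (isOpen_lt continuous_const Complex.continuous_re).inter
    (isOpen_lt Complex.continuous_re continuous_const)
  have hSc : Convex ℝ S := (convex_halfSpace_re_gt _).inter (convex_halfSpace_re_lt _)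
  have hexp : ∀ w ∈ S, Complex.exp w ∈ annulus k s := fun w hw => exp_mem_annulus_iff.2 hw
  have hneg : ∀ w ∈ S, -w ∈ S := fun w hw => by
    simp only [hS, Set.mem_ofPred_eq, Complex.neg_re] at hw ⊢
    constructor <;> linarith
  have hball : ∀ w ∈ S, Complex.exp w ∈ Metric.ball (0 : ℂ) R := fun w hw =>
    mem_ball_zero_iff.2 (hexp w hw).2
  have h0S : (0 : ℂ) ∈ S := by
    simp only [hS, Set.mem_ofPred_eq, Complex.zero_re]
    constructor <;> linarith
  -- The splitting is known only for `‖z‖ = 1`. Pulled back by `exp` to the convex strip it holds on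
  -- the imaginary axis, hence on the whole strip by the identity theorem.
  set φ : ℂ → ℂ := fun w => D (Complex.exp w) -
    (Complex.exp w * Q (Complex.exp w) - Complex.exp (-w) * Q (Complex.exp (-w))) with hφ
  have hφd : DifferentiableOn ℂ φ S := by
    have e1 : DifferentiableOn ℂ Complex.exp S := Complex.differentiable_exp.differentiableOn
    have e2 : DifferentiableOn ℂ (fun w => Complex.exp (-w)) S :=
      (Complex.differentiable_exp.comp differentiable_neg).differentiableOn
    exact (hD.comp e1 hexp).sub ((e1.mul (hQ.comp e1 hball)).sub
      (e2.mul (hQ.comp e2 fun w hw => hball _ (hneg w hw))))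
  have hφim : ∀ t : ℝ, φ (t * Complex.I) = 0 := fun t => by
    have hn : ‖Complex.exp (t * Complex.I)‖ = 1 := Complex.norm_exp_ofReal_mul_I t
    rw [hφ]
    simp only
    rw [hsplit _ hn, Complex.exp_neg, sub_self]
  have hφ0 : Set.EqOn φ 0 S := by
    refine (hφd.analyticOnNhd hSo).eqOn_zero_of_preconnected_of_frequently_eq_zero
      hSc.isPreconnected h0S ?_
    have ht : Tendsto (fun t : ℝ => (t : ℂ) * Complex.I) (𝓝[≠] 0) (𝓝[≠] 0) := by
      refine tendsto_nhdsWithin_iff.2 ⟨?_, ?_⟩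
      · have : Tendsto (fun t : ℝ => (t : ℂ) * Complex.I) (𝓝 0) (𝓝 ((0 : ℝ) * Complex.I)) :=
          (Continuous.tendsto (by fun_prop) 0)
        simpa using this.mono_left nhdsWithin_le_nhds
      · filter_upwards [self_mem_nhdsWithin] with t ht
        simpa using ht
    exact ht.frequently (Frequently.of_forall hφim)
  -- The logarithmic derivative of `K(z) exp (-(E(z) + E(1/z)))` is zero, so this function is
  -- constant.
  set F : ℂ → ℂ := fun w => kernel k s a (Complex.exp w) *
    Complex.exp (-(E (Complex.exp w) + E (Complex.exp (-w)))) with hF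
  have hFd : ∀ w ∈ S, HasDerivAt F 0 w := fun w hw => by
    have e1 := Complex.hasDerivAt_exp w
    have e2 : HasDerivAt (fun w => Complex.exp (-w)) (Complex.exp (-w) * -1) w :=
      (Complex.hasDerivAt_exp (-w)).comp w (hasDerivAt_neg w)
    have d1 := (hKat _ (hexp w hw)).comp w e1
    have d2 := (hE _ (hball w hw)).comp w e1
    have d3 := (hE _ (hball _ (hneg w hw))).comp w e2
    have d4 := d1.mul (d2.add d3).neg.cexp
    have hz : D (Complex.exp w) -
      (Complex.exp w * Q (Complex.exp w) - Complex.exp (-w) * Q (Complex.exp (-w))) = 0 :=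
      hφ0 hw
    have hne := hK _ (hexp w hw)
    have hD' : deriv (kernel k s a) (Complex.exp w) * Complex.exp w =
        kernel k s a (Complex.exp w) * D (Complex.exp w) := by
      rw [hDdef]
      field_simp
    refine d4.congr_deriv ?_
    simp only [Function.comp_apply, Pi.neg_apply, Pi.add_apply]
    rw [hD', sub_eq_zero.1 hz]
    ring
  have hFc : ∀ w ∈ S, F w = F 0 := fun w hw =>
    hSo.is_const_of_deriv_eq_zero hSc.isPreconnected
      (fun w hw => (hFd w hw).differentiableAt.differentiableWithinAt)
      (fun w hw => (hFd w hw).deriv) hw h0S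
  -- A square root shares the constant equally between `K⁺(z)` and `K⁺(1/z)`.
  obtain ⟨μ, hμ⟩ := IsAlgClosed.exists_pow_nat_eq (F 0) two_pos
  have hF0 : F 0 ≠ 0 := mul_ne_zero (hK _ (hexp 0 h0S)) (Complex.exp_ne_zero _)
  have hμ0 : μ ≠ 0 := fun h0 => hF0 (by rw [← hμ, h0]; simp)
  refine ⟨fun z => μ * Complex.exp (E z), ?_, fun z _ => mul_ne_zero hμ0 (Complex.exp_ne_zero _),
    fun z hz => ?_⟩
  · refine DifferentiableOn.analyticOnNhd (fun z hz => ?_) Metric.isOpen_ball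
    exact ((hE z hz).cexp.const_mul μ).differentiableAt.differentiableWithinAt
  · have hz0 := ne_zero_of_mem_annulus hz
    have hlog : Complex.log z ∈ S := by
      rw [← Complex.exp_log hz0] at hz
      exact exp_mem_annulus_iff.1 hz
    have h1 : kernel k s a z * (Complex.exp (E z + E z⁻¹))⁻¹ = F 0 := by
      rw [← hFc _ hlog, hF]
      simp only [Complex.exp_neg (Complex.log z), Complex.exp_log hz0]
      rw [Complex.exp_neg]
    have h2 : kernel k s a z = F 0 * Complex.exp (E z + E z⁻¹) := by
      rw [← h1, inv_mul_cancel_right₀ (Complex.exp_ne_zero _)]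
    rw [h2, ← hμ, Complex.exp_add]
    ring

/-! ### Taylor coefficients of the factors -/

section Factor

variable {k : ℂ} {s a : ℝ} {Kp : ℂ → ℂ}

lemma IsPlusFactor.differentiableOn (hKp : IsPlusFactor k s a Kp) :
    DifferentiableOn ℂ Kp (Metric.ball 0 (Real.exp (k.im * s))) :=
  hKp.analytic.differentiableOn

lemma IsPlusFactor.differentiableOn_inv (hKp : IsPlusFactor k s a Kp) :
    DifferentiableOn ℂ (fun z => (Kp z)⁻¹) (Metric.ball 0 (Real.exp (k.im * s))) :=
  hKp.differentiableOn.inv hKp.ne_zero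

lemma IsPlusFactor.hasSum_lam (hKp : IsPlusFactor k s a Kp) {z : ℂ}
    (hz : ‖z‖ < Real.exp (k.im * s)) : HasSum (fun n => lam Kp n * z ^ n) (Kp z)⁻¹ :=
  hasSum_taylor hKp.differentiableOn_inv hz

lemma IsPlusFactor.summable_lam (hKp : IsPlusFactor k s a Kp) {t : ℝ} (ht : 0 ≤ t)
    (htR : t < Real.exp (k.im * s)) : Summable fun n => ‖lam Kp n‖ * t ^ n :=
  summable_taylor hKp.differentiableOn_inv ht htR

/-- A Toeplitz system with the Laurent coefficients of the kernel is solved by the factors. -/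
lemma IsPlusFactor.system_iff (hKp : IsPlusFactor k s a Kp) (h : 0 < k.im * s) {A f : ℕ → ℂ}
    {t : ℝ} (ht : 1 ≤ t) (htR : t < Real.exp (k.im * s)) (hA : Grows t A) (hf : Grows t f) :
    (∀ m : ℕ, Summable fun n : ℕ => A n * kernelCoeff k s a ((m : ℤ) - n).natAbs) ∧
    ((∀ m : ℕ, ∑' n : ℕ, A n * kernelCoeff k s a ((m : ℤ) - n).natAbs = f m) ↔
      ∀ m, A m = lowerConv (lam Kp) (upperConv (lam Kp) f) m) := by
  have hR : 1 < Real.exp (k.im * s) := Real.one_lt_exp_iff.2 h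
  have ht0 : 0 ≤ t := by linarith
  set b : ℕ → ℂ := fun n => iteratedDeriv n Kp 0 / (n.factorial : ℂ) with hb
  have hbt : Summable fun n => ‖b n‖ * t ^ n := summable_taylor hKp.differentiableOn ht0 htR
  have hlt := hKp.summable_lam ht0 htR
  have hb1 := summable_norm_of_weighted ht hbt
  have hl1 := summable_norm_of_weighted ht hlt
  have hbs : ∀ z : ℂ, ‖z‖ = 1 → HasSum (fun n => b n * z ^ n) (Kp z) := fun z hz =>
    hasSum_taylor hKp.differentiableOn (by rwa [hz])
  have hls : ∀ z : ℂ, ‖z‖ = 1 → HasSum (fun n => lam Kp n * z ^ n) (Kp z)⁻¹ := fun z hz =>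
    hKp.hasSum_lam (by rwa [hz])
  have hinv : ConvInverse b (lam Kp) := convInverse_of_mul_eq_one hb1 hl1 hbs hls fun z hz =>
    mul_inv_cancel₀ (hKp.ne_zero z (mem_ball_zero_iff.2 (by rwa [hz])))
  have hκ := tsum_mul_zeroExt hb1 (summable_kernelCoeff_int a h) hbs
    (fun z hz => hasSum_kernel a h hz)
    fun z hz => hKp.factor z (mem_annulus_of_norm_eq_one h hz)
  exact ⟨fun m => (hasSum_toeplitz ht hbt hκ hA m).summable,
    toeplitz_system_iff ht hbt hlt hinv hκ hA hf⟩

/-- The Wiener-Hopf solution for a source that contains a geometric sequence. -/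
lemma IsPlusFactor.lowerConv_upperConv_sub (hKp : IsPlusFactor k s a Kp) {S : ℕ → ℂ} {t : ℝ}
    (ht : 0 ≤ t) (htR : t < Real.exp (k.im * s)) (hS : Grows t S) {w : ℂ} (hw0 : w ≠ 0)
    (hw : ‖w‖ < Real.exp (k.im * s)) (v : ℂ) (m : ℕ) :
    lowerConv (lam Kp) (upperConv (lam Kp) fun n => -S n - v * w ^ n) m =
      -(v * w ^ m / Kp w) * ∑ n ∈ Finset.range (m + 1), lam Kp n * (w ^ n)⁻¹
        - lowerConv (lam Kp) (upperConv (lam Kp) S) m := by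
  -- A geometric sequence is an eigenvector of the upper operator: `∑ λ_p w ^ (n + p) = w ^ n /
  -- K⁺(w)`.
  have hU : ∀ n, upperConv (lam Kp) (fun n => -S n - v * w ^ n) n =
      -(v * w ^ n / Kp w) - upperConv (lam Kp) S n := fun n => by
    have h1 := (summable_upperConv (hKp.summable_lam ht htR) hS n).of_norm.hasSum
    have h2 := (hKp.hasSum_lam hw).mul_left (v * w ^ n)
    have h3 := h2.neg.sub h1
    rw [upperConv, upperConv, div_eq_mul_inv, ← h3.tsum_eq]
    exact tsum_congr fun p => by rw [pow_add]; ring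
  have hrefl : ∑ n ∈ Finset.range (m + 1), lam Kp (m - n) * w ^ n =
      w ^ m * ∑ n ∈ Finset.range (m + 1), lam Kp n * (w ^ n)⁻¹ := by
    rw [← Finset.sum_range_reflect, Finset.mul_sum]
    refine Finset.sum_congr rfl fun n hn => ?_
    have hnm : n ≤ m := Nat.lt_succ_iff.1 (Finset.mem_range.1 hn)
    rw [show m + 1 - 1 - n = m - n by omega, Nat.sub_sub_self hnm, pow_sub₀ w hw0 hnm]
    ring
  calc lowerConv (lam Kp) (upperConv (lam Kp) fun n => -S n - v * w ^ n) m
      = -(v / Kp w) * ∑ n ∈ Finset.range (m + 1), lam Kp (m - n) * w ^ n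
        - lowerConv (lam Kp) (upperConv (lam Kp) S) m := by
        unfold lowerConv
        rw [Finset.mul_sum, ← Finset.sum_sub_distrib]
        refine Finset.sum_congr rfl fun n _ => ?_
        rw [hU]
        ring
    _ = _ := by rw [hrefl]; ring

end Factor

/-! ### The coupled systems -/

lemma planeWave_eq_pow (k : ℂ) (s c : ℝ) (m : ℕ) :
    planeWave k s c m = planeWave k s c 1 ^ m := by
  rw [planeWave, planeWave, ← Complex.exp_nat_mul]
  congr 1
  push_cast
  ring

/-- Excluding incidence along the array places the ratio of the plane wave inside the disc where
`1/K⁺` is analytic. -/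
lemma norm_planeWave_one_lt {k : ℂ} {s c : ℝ} (h : 0 < k.im * s) (hc : c < 1) :
    ‖planeWave k s c 1‖ < Real.exp (k.im * s) := by
  have hre : (-(Complex.I * k * s * (1 : ℕ) * c)).re = k.im * s * c := by
    simp [Complex.mul_re, Complex.mul_im]
  rw [planeWave, Complex.norm_exp, hre]
  exact Real.exp_lt_exp.2 (by nlinarith)

lemma planeWave_ne_zero (k : ℂ) (s c : ℝ) (m : ℕ) : planeWave k s c m ≠ 0 :=
  Complex.exp_ne_zero _

/-- The lower bound on distances keeps the argument away from the singularity at `0`; the common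
corner `m = n = 0` is never a pair of distinct scatterers. -/
lemma exists_norm_hankelH_wedgeDist_le {k : ℂ} {s α : ℝ} (h : 0 < k.im * s)
    (hα : 0 < Real.sin α) :
    ∃ E : ℝ, 0 ≤ E ∧ ∀ m n : ℕ, m ≠ 0 ∨ n ≠ 0 →
      ‖hankelH (k * s * (wedgeDist α m n : ℝ))‖ ≤
        E * Real.exp (-(k.im * s) * ((m : ℤ) - n).natAbs) := by
  obtain ⟨δ, hδ, hd⟩ := exists_le_wedgeDist hα
  obtain ⟨E, hE, hle⟩ := exists_norm_hankelH_le (mul_pos h hδ)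
  refine ⟨E, hE, fun m n hmn => ?_⟩
  have him : (k * s * (wedgeDist α m n : ℝ)).im = k.im * s * wedgeDist α m n := by
    simp [Complex.mul_im]
  refine (hle _ (by rw [him]; exact mul_le_mul_of_nonneg_left (hd m n hmn) h.le)).trans ?_
  rw [him, neg_mul]
  gcongr
  exact natAbs_sub_le_wedgeDist α m n

lemma hankelH_abs_sub (k : ℂ) (s a : ℝ) {m n : ℕ} (hmn : n ≠ m) :
    hankelH (k * s * (|(m : ℝ) - (n : ℝ)| : ℝ)) = kernelCoeff k s a ((m : ℤ) - n).natAbs := by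
  rw [kernelCoeff, if_neg (by omega), ← Complex.ofReal_natCast, Nat.cast_natAbs, Int.cast_abs]
  push_cast
  rfl

/-- The diagonal term split off a Toeplitz sum. -/
lemma offDiagonal {k : ℂ} {s a : ℝ} {A : ℕ → ℂ} {m : ℕ}
    (hs : Summable fun n : ℕ => A n * kernelCoeff k s a ((m : ℤ) - n).natAbs) :
    (Summable fun n : ℕ =>
      if n = m then 0 else A n * hankelH (k * s * (|(m : ℝ) - (n : ℝ)| : ℝ))) ∧
    A m * hankelH (k * a) +
        ∑' n : ℕ, (if n = m then 0 else A n * hankelH (k * s * (|(m : ℝ) - (n : ℝ)| : ℝ))) =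
      ∑' n : ℕ, A n * kernelCoeff k s a ((m : ℤ) - n).natAbs := by
  have h1 : (fun n : ℕ =>
      if n = m then 0 else A n * hankelH (k * s * (|(m : ℝ) - (n : ℝ)| : ℝ))) =
      fun n : ℕ => if n = m then 0 else A n * kernelCoeff k s a ((m : ℤ) - n).natAbs := by
    funext n
    split_ifs with hn
    · rfl
    · rw [hankelH_abs_sub k s a hn]
  rw [h1]
  refine ⟨Summable.of_norm (Summable.of_nonneg_of_le (fun n => norm_nonneg _) (fun n => ?_)
    hs.norm), ?_⟩
  · split_ifs <;> simp [mul_nonneg]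
  · rw [hs.tsum_eq_add_tsum_ite m]
    simp [kernelCoeff]

section Systems

variable {k : ℂ} {s a α θ : ℝ} {Kp : ℂ → ℂ}

/-- The upper array in terms of the lower one. -/
theorem topSystem_solution (h : 0 < k.im * s) (hα : 0 < Real.sin α)
    (hθ : Real.cos (θ - α) < 1) (hKp : IsPlusFactor k s a Kp) {B : ℕ+ → ℂ}
    (hB : AdmissibleBot k s B) :
    (∀ m : ℕ, Summable fun x : ℕ+ × ℕ => topTerm k s α Kp B m x.1 x.2) ∧
      AdmissibleTop k s (topFormula k s α θ Kp B) ∧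
      ∀ A : ℕ → ℂ, AdmissibleTop k s A →
        (TopSystem k s a α θ A B ↔ ∀ m : ℕ, A m = topFormula k s α θ Kp B m) := by
  obtain ⟨t, ht, htR, C, hC, hBC⟩ := (admissibleBot_iff h B).1 hB
  obtain ⟨E, hE, hM⟩ := exists_norm_hankelH_wedgeDist_le (k := k) h hα
  have ht0 : 0 ≤ t := by linarith
  have hD : ∀ q : ℕ+, ‖B q‖ ≤ C * t ^ (q : ℕ) := fun q => by
    have h1 := hBC q.natPred
    simp only [PNat.succPNat_natPred] at h1
    refine h1.trans ?_
    have : q.natPred ≤ q := by rw [← PNat.natPred_add_one q]; omega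
    gcongr
  have hM' : ∀ (n : ℕ) (q : ℕ+), ‖hankelH (k * s * (wedgeDist α n q : ℝ))‖ ≤
      E * Real.exp (-(k.im * s) * ((n : ℤ) - (q : ℕ)).natAbs) := fun n q =>
    hM n q (Or.inr q.ne_zero)
  set S : ℕ → ℂ := fun n => ∑' q : ℕ+, B q * hankelH (k * s * (wedgeDist α n q : ℝ)) with hSdef
  have hS : Grows t S := grows_source PNat.coe_injective ht htR hC hE hD hM'
  set w := planeWave k s (Real.cos (θ - α)) 1 with hw
  have hpw : ∀ n, planeWave k s (Real.cos (θ - α)) n = w ^ n := planeWave_eq_pow k s _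
  have hwR : ‖w‖ < Real.exp (k.im * s) := norm_planeWave_one_lt h hθ
  set f : ℕ → ℂ := fun n => -S n - 1 * w ^ n with hf
  have hfg : ∀ u, t ≤ u → ‖w‖ ≤ u → Grows u f := fun u h1 h2 => by
    have := (hS.mono ht0 h1).neg.add (grows_pow w h2).neg
    simpa only [hf, one_mul, ← sub_eq_add_neg] using this
  have hterm : ∀ (m : ℕ) (q : ℕ+) (p : ℕ), topTerm k s α Kp B m q p =
      ∑ n ∈ Finset.range (m + 1), lam Kp (m - n) * lam Kp p * B q *
        hankelH (k * s * (wedgeDist α (p + n) q : ℝ)) := fun m q p =>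
    Finset.sum_congr rfl fun n _ => by rw [wedgeDist_comm]
  have hdouble := fun m => lowerConv_upperConv_source (M := fun n (q : ℕ+) =>
    hankelH (k * s * (wedgeDist α n q : ℝ))) PNat.coe_injective ht htR hC hE hD hM'
    (hKp.summable_lam ht0 htR) m
  have hformula : ∀ m, topFormula k s α θ Kp B m =
      lowerConv (lam Kp) (upperConv (lam Kp) f) m := fun m => by
    rw [hf, hKp.lowerConv_upperConv_sub ht0 htR hS (planeWave_ne_zero _ _ _ _) hwR 1 m,
      (hdouble m).2, topFormula, isoTop]
    simp_rw [hterm, hpw, one_mul, pow_one]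
  refine ⟨fun m => ?_, ?_, fun A hA => ?_⟩
  · simp_rw [hterm]
    exact (hdouble m).1
  · have hu : max t ‖w‖ < Real.exp (k.im * s) := max_lt htR hwR
    have hu1 : 1 ≤ max t ‖w‖ := le_max_of_le_left ht
    have hu0 : 0 ≤ max t ‖w‖ := by linarith
    have hl := hKp.summable_lam hu0 hu
    rw [admissibleTop_iff h, funext hformula]
    exact ⟨_, hu1, hu, grows_lowerConv hu1 (summable_norm_of_weighted hu1 hl)
      (grows_upperConv hu0 hl (hfg _ (le_max_left _ _) (le_max_right _ _)))⟩
  · obtain ⟨u, hu, huR, hAu⟩ := (admissibleTop_iff h A).1 hA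
    -- One growth rate must serve the unknown, the field of the other array and the plane wave.
    obtain ⟨hs, hiff⟩ := hKp.system_iff h (t := max u (max t ‖w‖)) (le_max_of_le_left hu)
      (max_lt huR (max_lt htR hwR)) (hAu.mono (by linarith) (le_max_left _ _))
      (hfg _ (le_max_of_le_right (le_max_left _ _)) (le_max_of_le_right (le_max_right _ _)))
    simp_rw [hformula]
    rw [← hiff]
    refine forall_congr' fun m => ?_
    have hoff := offDiagonal (hs m)
    have hsrc : Summable fun n : ℕ+ => B n * hankelH (k * s * (wedgeDist α m n : ℝ)) :=
      (summable_source PNat.coe_injective ht htR hC hD hM' m).of_norm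
    rw [hoff.2, and_iff_right hoff.1, and_iff_right hsrc, hpw]
    simp only [hf, one_mul, hSdef]

/-- The lower array in terms of the upper one. -/
theorem botSystem_solution (h : 0 < k.im * s) (hα : 0 < Real.sin α)
    (hθ : Real.cos (θ + α) < 1) (hKp : IsPlusFactor k s a Kp) {A : ℕ → ℂ}
    (hA : AdmissibleTop k s A) :
    (∀ m : ℕ+, Summable fun x : ℕ × ℕ => botTerm k s α Kp A m x.1 x.2) ∧
      AdmissibleBot k s (botFormula k s α θ Kp A) ∧
      ∀ B : ℕ+ → ℂ, AdmissibleBot k s B →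
        (BotSystem k s a α θ A B ↔ ∀ m : ℕ+, B m = botFormula k s α θ Kp A m) := by
  obtain ⟨t, ht, htR, C, hC, hD⟩ := (admissibleTop_iff h A).1 hA
  obtain ⟨E₀, hE₀, hM⟩ := exists_norm_hankelH_wedgeDist_le (k := k) h hα
  have ht0 : 0 ≤ t := by linarith
  -- Row `n` stands for the scatterer `-(n + 1)`; the shift by one costs a factor `exp (s Im k)` in
  -- the off-diagonal bound.
  set E := E₀ * Real.exp (k.im * s) with hEdef
  have hE : 0 ≤ E := by positivity
  have hM' : ∀ (n : ℕ) (q : ℕ), ‖hankelH (k * s * (wedgeDist α (n + 1) q : ℝ))‖ ≤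
      E * Real.exp (-(k.im * s) * ((n : ℤ) - (q : ℕ)).natAbs) := fun n q => by
    refine (hM (n + 1) q (Or.inl n.succ_ne_zero)).trans ?_
    rw [hEdef, mul_assoc, ← Real.exp_add]
    have h1 : ((n : ℤ) - q).natAbs ≤ (((n + 1 : ℕ) : ℤ) - q).natAbs + 1 := by omega
    have h2 : ((((n : ℤ) - q).natAbs : ℕ) : ℝ) ≤ (((n + 1 : ℕ) : ℤ) - q).natAbs + 1 := by
      exact_mod_cast h1
    have h3 := mul_le_mul_of_nonneg_left h2 h.le
    gcongr
    linarith
  have hinj : Function.Injective fun q : ℕ => q := fun _ _ h => h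
  set S : ℕ → ℂ := fun n => ∑' q : ℕ, A q * hankelH (k * s * (wedgeDist α (n + 1) q : ℝ))
    with hSdef
  have hS : Grows t S := grows_source hinj ht htR hC hE hD hM'
  set w := planeWave k s (Real.cos (θ + α)) 1 with hw
  have hpw : ∀ n, planeWave k s (Real.cos (θ + α)) n = w ^ n := planeWave_eq_pow k s _
  have hwR : ‖w‖ < Real.exp (k.im * s) := norm_planeWave_one_lt h hθ
  -- The plane wave at index `n + 1` is `w * w ^ n`, hence the amplitude `w` here and `1` for the
  -- upper array.
  set f : ℕ → ℂ := fun n => -S n - w * w ^ n with hf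
  have hfg : ∀ u, t ≤ u → ‖w‖ ≤ u → Grows u f := fun u h1 h2 => by
    have := (hS.mono ht0 h1).neg.add ((grows_pow w h2).shift (ht0.trans h1)).neg
    simpa only [hf, ← pow_succ', ← sub_eq_add_neg] using this
  have hterm : ∀ (m q p : ℕ), botTerm k s α Kp A m.succPNat q p =
      ∑ n ∈ Finset.range (m + 1), lam Kp (m - n) * lam Kp p * A q *
        hankelH (k * s * (wedgeDist α (p + n + 1) q : ℝ)) := fun m q p => by
    rw [botTerm, Nat.succPNat_coe, ← Finset.Ico_add_one_right_eq_Icc,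
      Finset.sum_Ico_eq_sum_range]
    refine Finset.sum_congr (by simp) fun n _ => ?_
    rw [wedgeDist_comm, show p + (1 + n) = p + n + 1 by omega,
      show m.succ - (1 + n) = m - n by omega]
  have hdouble := fun m => lowerConv_upperConv_source (M := fun n (q : ℕ) =>
    hankelH (k * s * (wedgeDist α (n + 1) q : ℝ))) hinj ht htR hC hE hD hM'
    (hKp.summable_lam ht0 htR) m
  have hformula : ∀ m : ℕ, botFormula k s α θ Kp A m.succPNat =
      lowerConv (lam Kp) (upperConv (lam Kp) f) m := fun m => by
    rw [hf, hKp.lowerConv_upperConv_sub ht0 htR hS (planeWave_ne_zero _ _ _ _) hwR w m,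
      (hdouble m).2, botFormula, isoBot]
    simp_rw [hterm, hpw, pow_one, Nat.succPNat_coe, Nat.succ_eq_add_one, ← pow_succ']
  have hall : ∀ P : ℕ+ → Prop, (∀ m, P m) ↔ ∀ m : ℕ, P m.succPNat := fun P =>
    Equiv.pnatEquivNat.symm.forall_congr_right.symm
  refine ⟨(hall _).2 fun m => ?_, ?_, fun B hB => ?_⟩
  · simp_rw [hterm]
    exact (hdouble m).1
  · have hu : max t ‖w‖ < Real.exp (k.im * s) := max_lt htR hwR
    have hu1 : 1 ≤ max t ‖w‖ := le_max_of_le_left ht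
    have hu0 : 0 ≤ max t ‖w‖ := by linarith
    have hl := hKp.summable_lam hu0 hu
    rw [admissibleBot_iff h, funext hformula]
    exact ⟨_, hu1, hu, grows_lowerConv hu1 (summable_norm_of_weighted hu1 hl)
      (grows_upperConv hu0 hl (hfg _ (le_max_left _ _) (le_max_right _ _)))⟩
  · obtain ⟨u, hu, huR, hBu⟩ := (admissibleBot_iff h B).1 hB
    obtain ⟨hs, hiff⟩ := hKp.system_iff h (t := max u (max t ‖w‖)) (le_max_of_le_left hu)
      (max_lt huR (max_lt htR hwR)) (hBu.mono (by linarith) (le_max_left _ _))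
      (hfg _ (le_max_of_le_right (le_max_left _ _)) (le_max_of_le_right (le_max_right _ _)))
    rw [hall fun m => B m = botFormula k s α θ Kp A m]
    simp_rw [hformula]
    rw [← hiff, BotSystem, hall]
    refine forall_congr' fun m => ?_
    have hoff := offDiagonal (hs m)
    -- Differences of indices are unchanged by the shift, so the lower system becomes the same
    -- Toeplitz system on `n ≥ 0`.
    have hshift : ((fun n : ℕ+ => if n = m.succPNat then 0
        else B n * hankelH (k * s * (|((m.succPNat : ℕ) : ℝ) - ((n : ℕ) : ℝ)| : ℝ))) ∘
          Equiv.pnatEquivNat.symm) =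
        fun n : ℕ => if n = m then 0
          else B n.succPNat * hankelH (k * s * (|(m : ℝ) - (n : ℝ)| : ℝ)) := by
      funext n
      simp [Equiv.pnatEquivNat, Nat.succPNat_inj]
    have hsrc : Summable fun n : ℕ => A n * hankelH (k * s * (wedgeDist α (m + 1) n : ℝ)) :=
      (summable_source hinj ht htR hC hD hM' m).of_norm
    rw [← Equiv.pnatEquivNat.symm.summable_iff, hshift, ← Equiv.pnatEquivNat.symm.tsum_eq]
    have htsum := congrArg (fun g : ℕ → ℂ => ∑' n, g n) hshift
    simp only [Function.comp_apply] at htsum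
    rw [htsum, hoff.2, and_iff_right hoff.1, Nat.succPNat_coe, and_iff_right hsrc,
      hpw]
    simp only [hf, hSdef, Nat.succ_eq_add_one, pow_succ']

end Systems

/-! ### The isolated arrays as the uncoupled case -/

section Isolated

variable {k : ℂ} {s α θ : ℝ} {Kp : ℂ → ℂ}

lemma topFormula_zero : topFormula k s α θ Kp 0 = isoTop k s α θ Kp := by
  funext m
  simp [topFormula, topTerm]

lemma botFormula_zero : botFormula k s α θ Kp 0 = isoBot k s α θ Kp := by
  funext m
  simp [botFormula, botTerm]

lemma admissibleTop_zero (h : 0 < k.im * s) : AdmissibleTop k s 0 :=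
  (admissibleTop_iff h 0).2 ⟨1, le_rfl, Real.one_lt_exp_iff.2 h, 0, le_rfl, by simp⟩

lemma admissibleBot_zero (h : 0 < k.im * s) : AdmissibleBot k s 0 :=
  (admissibleBot_iff h 0).2 ⟨1, le_rfl, Real.one_lt_exp_iff.2 h, 0, le_rfl, by simp⟩

end Isolated

end WedgeScatterers

end

/-! ### The main theorem -/

open WedgeScatterers in
theorem mainTheorem1 (s a α θ : ℝ) (hs : 0 < s) (ha : 0 < a) (has : a < s / 2)
    (hα : 0 ≤ α) (hα' : α < Real.pi) (hsin : a / s < Real.sin α)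
    (hθA : Real.cos (θ - α) < 1) (hθB : Real.cos (θ + α) < 1) :
    -- wave numbers with positive imaginary part and a zero-free kernel
    (∀ k : ℂ, 0 < k.im → (∀ z ∈ annulus k s, kernel k s a z ≠ 0) →
      -- the kernel has a Wiener-Hopf factorisation
      (∃ Kp : ℂ → ℂ, IsPlusFactor k s a Kp) ∧
      ∀ Kp : ℂ → ℂ, IsPlusFactor k s a Kp →
        -- the isolated coefficients are the solutions of the isolated systems
        (AdmissibleTop k s (isoTop k s α θ Kp) ∧
          ∀ A : ℕ → ℂ, AdmissibleTop k s A →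
            (TopSystem k s a α θ A 0 ↔ ∀ m : ℕ, A m = isoTop k s α θ Kp m)) ∧
        (AdmissibleBot k s (isoBot k s α θ Kp) ∧
          ∀ B : ℕ+ → ℂ, AdmissibleBot k s B →
            (BotSystem k s a α θ 0 B ↔ ∀ m : ℕ+, B m = isoBot k s α θ Kp m)) ∧
        -- the upper array in terms of the lower one
        (∀ B : ℕ+ → ℂ, AdmissibleBot k s B →
          (∀ m : ℕ, Summable fun x : ℕ+ × ℕ => topTerm k s α Kp B m x.1 x.2) ∧
          AdmissibleTop k s (topFormula k s α θ Kp B) ∧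
          ∀ A : ℕ → ℂ, AdmissibleTop k s A →
            (TopSystem k s a α θ A B ↔ ∀ m : ℕ, A m = topFormula k s α θ Kp B m)) ∧
        -- the lower array in terms of the upper one
        (∀ A : ℕ → ℂ, AdmissibleTop k s A →
          (∀ m : ℕ+, Summable fun x : ℕ × ℕ => botTerm k s α Kp A m x.1 x.2) ∧
          AdmissibleBot k s (botFormula k s α θ Kp A) ∧
          ∀ B : ℕ+ → ℂ, AdmissibleBot k s B →
            (BotSystem k s a α θ A B ↔ ∀ m : ℕ+, B m = botFormula k s α θ Kp A m))) ∧
    -- real wave numbers, in the limit of vanishing imaginary part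
    (∀ (k₀ : ℝ) (k : ℕ → ℂ), 0 < k₀ → (∀ j, 0 < (k j).im) →
      Filter.Tendsto k Filter.atTop (nhds (k₀ : ℂ)) →
      (∀ j, ∀ z ∈ annulus (k j) s, kernel (k j) s a z ≠ 0) →
      ∀ Kp : ℕ → ℂ → ℂ, (∀ j, IsPlusFactor (k j) s a (Kp j)) →
      ∀ (A : ℕ → ℕ → ℂ) (B : ℕ → ℕ+ → ℂ),
        (∀ j, AdmissibleTop (k j) s (A j)) → (∀ j, AdmissibleBot (k j) s (B j)) →
        (∀ j, TopSystem (k j) s a α θ (A j) (B j)) →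
        (∀ j, BotSystem (k j) s a α θ (A j) (B j)) →
        ∀ (A' : ℕ → ℂ) (B' : ℕ+ → ℂ),
          (∀ m, Filter.Tendsto (fun j => A j m) Filter.atTop (nhds (A' m))) →
          (∀ m, Filter.Tendsto (fun j => B j m) Filter.atTop (nhds (B' m))) →
          (∀ m, Filter.Tendsto (fun j => topFormula (k j) s α θ (Kp j) (B j) m)
            Filter.atTop (nhds (A' m))) ∧
          (∀ m, Filter.Tendsto (fun j => botFormula (k j) s α θ (Kp j) (A j) m)
            Filter.atTop (nhds (B' m)))) := by
  have hsinα : 0 < Real.sin α := (div_pos ha hs).trans hsin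
  have him : ∀ k : ℂ, 0 < k.im → 0 < k.im * s := fun k hk => mul_pos hk hs
  refine ⟨fun k hk hK => ⟨exists_isPlusFactor (him k hk) hK, fun Kp hKp => ?_⟩, ?_⟩
  · have hσ := him k hk
    have htop := topSystem_solution (θ := θ) hσ hsinα hθA hKp (admissibleBot_zero hσ)
    have hbot := botSystem_solution (θ := θ) hσ hsinα hθB hKp (admissibleTop_zero hσ)
    rw [topFormula_zero] at htop
    rw [botFormula_zero] at hbot
    exact ⟨htop.2, hbot.2, fun B hB => topSystem_solution hσ hsinα hθA hKp hB,
      fun A hA => botSystem_solution hσ hsinα hθB hKp hA⟩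
  · intro _ k _ hk _ _ Kp hKp A B hA hB hAB hBA A' B' hA' hB'
    -- For each `j` the right-hand sides equal `A j m` and `B j m` exactly, so the assumed termwise
    -- limits are the limits of the formulas.
    refine ⟨fun m => (hA' m).congr fun j => ?_, fun m => (hB' m).congr fun j => ?_⟩
    · exact ((topSystem_solution (him _ (hk j)) hsinα hθA (hKp j) (hB j)).2.2 _ (hA j)).1
        (hAB j) m
    · exact ((botSystem_solution (him _ (hk j)) hsinα hθB (hKp j) (hA j)).2.2 _ (hB j)).1
        (hBA j) m
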